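/- All Banach spaces are over the same field $\mathbb F\in\{\mathbb R,\mathbb C\}$, and bases are indexed by countable sets. An unconditional basis of a Banach space $X$ is a countable family $(x_i)_{i\in N}$ in $X$, with biorthogonal functionals $(x_i^*)_{i\in N}$ in $X^*$, such that $f=\sum_{i} x_i^*(f)\,x_i$ unconditionally for every $f\in X$; the support of $f$ is $\{i: x_i^*(f)\neq 0\}$. For $0<q\le\infty$, such a basis satisfies an upper $q$-estimate (resp. a lower $q$-estimate) if there is a constant $C$ with $\|\sum_k f_k\|\le C(\sum_k\|f_k\|^q)^{1/q}$ (resp. $(\sum_k\|f_k\|^q)^{1/q}\le C\|\sum_k f_k\|$) for every finite family $(f_k)$ in $X$ of vectors with pairwise disjoint supports, where $(\sum_k\|f_k\|^q)^{1/q}$ means $\max_k\|f_k\|$ if $q=\infty$. The basis is semi-normalized if $0<\inf_i\|x_i\|$ and $\sup_i\|x_i\|<\infty$. Let $n\ge 1$. Unconditional bases $\mathcal B_1,\dots,\mathcal B_n$ of Banach spaces $X_1,\dots,X_n$ are called lattice-estimate disjoint if there is a non-decreasing sequence $(q_j)_{j=1}^{n-1}$ in $(0,\infty]$ such that for every $1\le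 j\le n-1$: $\mathcal B_j$ satisfies a lower $q_j$-estimate; $\mathcal B_{j+1}$ satisfies an upper $q_j$-estimate; and at least one of $X_j$, $X_{j+1}$ contains no subspace isomorphic to $\ell_{q_j}$ (where $\ell_\infty$ is to be read as $c_0$). A Banach space $X$ has a UTAP (unique up to a permutation) unconditional basis if it has a semi-normalized unconditional basis $\mathcal B$ and every semi-normalized unconditional basis of $X$ is equivalent to a permutation of $\mathcal B$, i.e. for every semi-normalized unconditional basis $(y_k)_{k\in M}$ of $X$, writing $\mathcal B=(x_i)_{i\in N}$, there are a bijection $\pi\colon N\to M$ and an isomorphism $T\colon X\to X$ with $T(x_i)=y_{\pi(i)}$ for all $i\in N$. **Theorem.** Let $X_1,\dots,X_n$ be Banach spaces with unconditional bases $\mathcal B_1,\dots,\mathcal B_n$, where $X_j$ is infinite-dimensional for $1<j<n$, and suppose that $(\mathcal B_j)_{j=1}^n$ is lattice-estimate disjoint. Then $(X_j)_{j=1}^n$ is splitting for unconditional bases: for every unconditional basis $(u_i)_{i\in N}$ of $\bigoplus_{j=1}^n X_j$ there is a partition of $N$ into (possibly empty) sets $N_1,\dots,N_n$ such that, for each $j$,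 the closed linear span of $(u_i)_{i\in N_j}$ is isomorphic to $X_j$. In particular, if each $X_j$ has a UTAP unconditional basis, then $\bigoplus_{j=1}^n X_j$ has a UTAP unconditional basis. -/

import Mathlib

open scoped ENNReal

noncomputable section

namespace SplitUB

section Bases

variable {𝕜 : Type*} [RCLike 𝕜] {X : Type*} [NormedAddCommGroup X] [NormedSpace 𝕜 X]
  {Y : Type*} [NormedAddCommGroup Y] [NormedSpace 𝕜 Y] {ι : Type*} {κ : Type*}

/-- The support of a vector with respect to an unconditional basis. -/
def supp (b : UnconditionalSchauderBasis ι 𝕜 X) (f : X) : Set ι :=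
  {i | b.coord i f ≠ 0}

/-- A finite family of vectors with pairwise disjoint supports. -/
def DisjointlySupported (b : UnconditionalSchauderBasis ι 𝕜 X) {m : ℕ} (f : Fin m → X) : Prop :=
  ∀ k l, k ≠ l → Disjoint (supp b (f k)) (supp b (f l))

/-- The lattice structure induced by the basis satisfies an upper `q`-estimate:
`‖∑ f k‖ ≤ C (∑ ‖f k‖ ^ q) ^ (1 / q)` for disjointly supported finite families
(with `max ‖f k‖` on the right if `q = ∞`). -/
def UpperEstimate (b : UnconditionalSchauderBasis ι 𝕜 X) (q : ℝ≥0∞) : Prop :=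
  ∃ C : ℝ, ∀ (m : ℕ) (f : Fin m → X), DisjointlySupported b f →
    ‖∑ k, f k‖ ≤ C * ‖(WithLp.toLp q f : PiLp q fun _ : Fin m => X)‖

/-- The lattice structure induced by the basis satisfies a lower `q`-estimate:
`(∑ ‖f k‖ ^ q) ^ (1 / q) ≤ C ‖∑ f k‖` for disjointly supported finite families
(with `max ‖f k‖` on the left if `q = ∞`). -/
def LowerEstimate (b : UnconditionalSchauderBasis ι 𝕜 X) (q : ℝ≥0∞) : Prop :=
  ∃ C : ℝ, ∀ (m : ℕ) (f : Fin m → X), DisjointlySupported b f →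
    ‖(WithLp.toLp q f : PiLp q fun _ : Fin m => X)‖ ≤ C * ‖∑ k, f k‖

/-- The basis vectors are bounded, and bounded away from zero. -/
def SemiNormalized (b : UnconditionalSchauderBasis ι 𝕜 X) : Prop :=
  ∃ c C : ℝ, 0 < c ∧ ∀ i, c ≤ ‖b i‖ ∧ ‖b i‖ ≤ C

/-- Two bases are equivalent up to a permutation: some isomorphism of the spaces
carries one basis onto a rearrangement of the other. -/
def PermEquivalent (b : UnconditionalSchauderBasis ι 𝕜 X)
    (b' : UnconditionalSchauderBasis κ 𝕜 Y) : Prop :=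
  ∃ (π : ι ≃ κ) (T : X ≃L[𝕜] Y), ∀ i, T (b i) = b' (π i)

end Bases

section Spaces

variable (𝕜 : Type*) [RCLike 𝕜]

/-- `X` has a closed subspace isomorphic to `ℓ_q`, where `ℓ_∞` is replaced with `c₀`.
The case `q < 1`, in which `ℓ_q` is only quasi-normed, is included; this is why for finite `q`
the two bounds of the embedding are spelled out. -/
def ContainsLq (X : Type*) [NormedAddCommGroup X] [NormedSpace 𝕜 X] (q : ℝ≥0∞) : Prop :=
  (q ≠ ∞ ∧ ∃ (T : lp (fun _ : ℕ => 𝕜) q →ₗ[𝕜] X) (c C : ℝ), 0 < c ∧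
    ∀ a, c * ‖a‖ ≤ ‖T a‖ ∧ ‖T a‖ ≤ C * ‖a‖) ∨
  (q = ∞ ∧ ∃ (T : ZeroAtInftyContinuousMap ℕ 𝕜 →ₗ[𝕜] X) (c C : ℝ), 0 < c ∧
    ∀ a, c * ‖a‖ ≤ ‖T a‖ ∧ ‖T a‖ ≤ C * ‖a‖)

/-- `X` has a UTAP (unique up to a permutation) unconditional basis: it has a semi-normalized
unconditional basis, and any other one is equivalent to a permutation of it. Bases are
countable families; a countable index set may be taken in `Type`. -/
def HasUTAPBasis (X : Type*) [NormedAddCommGroup X] [NormedSpace 𝕜 X] : Prop :=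
  ∃ (ι : Type) (_ : Countable ι) (b : UnconditionalSchauderBasis ι 𝕜 X), SemiNormalized b ∧
    ∀ (κ : Type) (_ : Countable κ) (b' : UnconditionalSchauderBasis κ 𝕜 X),
      SemiNormalized b' → PermEquivalent b b'

/-- Every unconditional basis of the direct sum of the `X j` can be partitioned into
subfamilies, one for each `j`, whose closed linear spans are isomorphic to the `X j`.
The map `σ` says to which part a basis vector belongs. -/
def SplittingForUnconditionalBases {J : Type*} [Fintype J] (X : J → Type*)
    [∀ j, NormedAddCommGroup (X j)] [∀ j, NormedSpace 𝕜 (X j)] : Prop :=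
  ∀ (ι : Type) (_ : Countable ι) (b : UnconditionalSchauderBasis ι 𝕜 (∀ j, X j)),
    ∃ σ : ι → J, ∀ j,
      Nonempty ((Submodule.span 𝕜 (b '' {i | σ i = j})).topologicalClosure ≃L[𝕜] X j)

end Spaces

/-- Lattice-estimate disjointness of bases `B 0, …, B n` of spaces `X 0, …, X n`. -/
def LatticeEstimateDisjoint {𝕜 : Type*} [RCLike 𝕜] {n : ℕ} {X : Fin (n + 1) → Type*}
    [∀ j, NormedAddCommGroup (X j)] [∀ j, NormedSpace 𝕜 (X j)] {ι : Fin (n + 1) → Type*}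
    (B : ∀ j, UnconditionalSchauderBasis (ι j) 𝕜 (X j)) : Prop :=
  ∃ q : Fin n → ℝ≥0∞, (∀ j, 0 < q j) ∧ Monotone q ∧ ∀ j : Fin n,
    LowerEstimate (B j.castSucc) (q j) ∧ UpperEstimate (B j.succ) (q j) ∧
    (¬ ContainsLq 𝕜 (X j.castSucc) (q j) ∨ ¬ ContainsLq 𝕜 (X j.succ) (q j))

end SplitUB

end

/-!
A noncompact operator `X k → X j` with `j < k` maps, by the gliding hump argument of Pitt's theorem,
some disjointly supported sequence to an almost disjointly supported one. The upper estimate in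
`X k` and the lower estimate in `X j` then make both of them equivalent to the basis of the same
`ℓ_q`, which lattice-estimate disjointness rules out. Hence all operators from later to earlier
summands are compact.

Let `P` be the projection of `Z = U × V` onto `U`, where all operators `V → U` are compact, and let
`(u i)` be an unconditional basis of `Z`. For all changes of signs `θ` of the basis, the
off-diagonal part of the conjugate of `P` by `θ` is compact, uniformly in `θ` by the Baire category
theorem. Averaging over the signs shows that `P` is, up to a compact error, the multiplier by its
diagonal, so that the indices with large diagonal entries span `U` up to finite dimensions. Moving
finitely many basis vectors makes the dimensions match.
-/

noncomputable section

namespace SplitUB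

open Filter Topology Set Function
open scoped lp

section Coordinates

variable {𝕜 : Type*} [RCLike 𝕜] {Z : Type*} [NormedAddCommGroup Z] [NormedSpace 𝕜 Z]
  {ι : Type*} {b : UnconditionalSchauderBasis ι 𝕜 Z}

lemma coord_self (i : ι) : b.coord i (b i) = 1 := by simp [b.ortho]

lemma coord_of_ne {i j : ι} (h : i ≠ j) : b.coord i (b j) = 0 := by simp [b.ortho, h]

lemma coord_eq_of_hasSum {a : ι → 𝕜} {z : Z} (h : HasSum (fun i => a i • b i) z) (i : ι) :
    b.coord i z = a i := by
  have hz : HasSum (fun j => b.coord i (a j • b j)) (b.coord i (a i • b i)) :=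
    hasSum_single i fun j hj => by simp [coord_of_ne hj.symm]
  simpa [coord_self] using ((b.coord i).hasSum h).unique hz

lemma ext_coord {x y : Z} (h : ∀ i, b.coord i x = b.coord i y) : x = y :=
  (b.expansion x).unique (by simpa only [h] using b.expansion y)

open scoped Classical in
lemma coord_proj (s : Finset ι) (z : Z) (i : ι) :
    b.coord i (b.proj s z) = if i ∈ s then b.coord i z else 0 := by
  simp [b.ortho, Pi.single_apply]

lemma eventually_norm_sub_proj_lt (b : UnconditionalSchauderBasis ι 𝕜 Z) (z : Z) {δ : ℝ}
    (hδ : 0 < δ) : ∀ᶠ s in atTop, ‖z - b.proj s z‖ < δ := by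
  have h := b.tendsto_proj z
  rw [SummationFilter.unconditional_filter] at h
  filter_upwards [Metric.tendsto_nhds.1 h δ hδ] with s hs
  rwa [← dist_eq_norm, dist_comm]

lemma separableSpace_of_basis [Countable ι] (b : UnconditionalSchauderBasis ι 𝕜 Z) :
    TopologicalSpace.SeparableSpace Z := by
  rw [← TopologicalSpace.isSeparable_univ_iff]
  refine (Set.countable_range b).isSeparable.span (R := 𝕜) |>.closure.mono fun z _ => ?_
  have h := b.tendsto_proj z
  rw [SummationFilter.unconditional_filter] at h
  refine mem_closure_of_tendsto h (Eventually.of_forall fun s => ?_)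
  rw [b.proj_apply]
  exact Submodule.sum_mem _ fun i _ => Submodule.smul_mem _ _ (Submodule.subset_span ⟨i, rfl⟩)

end Coordinates

section Multipliers

variable {𝕜 : Type*} [RCLike 𝕜] {Z : Type*} [NormedAddCommGroup Z] [NormedSpace 𝕜 Z] {ι : Type*}

lemma sum_abs_le_of_forall_subset {s : Finset ι} {r : ι → ℝ} {B : ℝ}
    (h : ∀ t ⊆ s, |∑ i ∈ t, r i| ≤ B) : ∑ i ∈ s, |r i| ≤ 2 * B := by
  have hpos := h (s.filter (0 ≤ r ·)) (Finset.filter_subset _ _)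
  have hneg := h (s.filter (¬ 0 ≤ r ·)) (Finset.filter_subset _ _)
  calc ∑ i ∈ s, |r i|
      = ∑ i ∈ s with 0 ≤ r i, r i - ∑ i ∈ s with ¬ 0 ≤ r i, r i := by
        rw [← Finset.sum_filter_add_sum_filter_not s (0 ≤ r ·), sub_eq_add_neg,
          ← Finset.sum_neg_distrib]
        congr 1 <;> refine Finset.sum_congr rfl fun i hi => ?_
        · exact abs_of_nonneg (Finset.mem_filter.1 hi).2
        · exact abs_of_neg (not_le.1 (Finset.mem_filter.1 hi).2)
    _ ≤ 2 * B := by linarith [abs_le.1 hpos, abs_le.1 hneg]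

lemma norm_le_abs_re_add_abs_im (a : 𝕜) : ‖a‖ ≤ |RCLike.re a| + |RCLike.im a| := by
  refine (sq_le_sq₀ (norm_nonneg _) (by positivity)).1 ?_
  rw [RCLike.norm_sq_eq_def, add_sq, sq_abs, sq_abs]
  nlinarith [mul_nonneg (abs_nonneg (RCLike.re a)) (abs_nonneg (RCLike.im a))]

lemma sum_norm_le_of_forall_subset {s : Finset ι} {a : ι → 𝕜} {B : ℝ}
    (h : ∀ t ⊆ s, ‖∑ i ∈ t, a i‖ ≤ B) : ∑ i ∈ s, ‖a i‖ ≤ 4 * B := by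
  have hre : ∑ i ∈ s, |RCLike.re (a i)| ≤ 2 * B := sum_abs_le_of_forall_subset fun t ht => by
    simpa only [map_sum] using (RCLike.abs_re_le_norm _).trans (h t ht)
  have him : ∑ i ∈ s, |RCLike.im (a i)| ≤ 2 * B := sum_abs_le_of_forall_subset fun t ht => by
    simpa only [map_sum] using (RCLike.abs_im_le_norm _).trans (h t ht)
  calc ∑ i ∈ s, ‖a i‖
      ≤ ∑ i ∈ s, (|RCLike.re (a i)| + |RCLike.im (a i)|) :=
        Finset.sum_le_sum fun i _ => norm_le_abs_re_add_abs_im _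
    _ ≤ 4 * B := by rw [Finset.sum_add_distrib]; linarith

lemma norm_sum_smul_le {s : Finset ι} {x : ι → Z} {μ : ι → 𝕜} {B C : ℝ} (hC : ∀ i ∈ s, ‖μ i‖ ≤ C)
    (h : ∀ t ⊆ s, ‖∑ i ∈ t, x i‖ ≤ B) (hC₀ : 0 ≤ C) : ‖∑ i ∈ s, μ i • x i‖ ≤ 4 * B * C := by
  obtain ⟨g, hg, hgx⟩ := exists_dual_vector'' 𝕜 (∑ i ∈ s, μ i • x i)
  have hgB : ∑ i ∈ s, ‖g (x i)‖ ≤ 4 * B := sum_norm_le_of_forall_subset fun t ht => by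
    rw [← map_sum]
    exact (g.le_of_opNorm_le hg _).trans (by simpa using h t ht)
  calc ‖∑ i ∈ s, μ i • x i‖ = ‖g (∑ i ∈ s, μ i • x i)‖ := by simp [hgx]
    _ ≤ ∑ i ∈ s, ‖μ i‖ * ‖g (x i)‖ := by
        simpa only [map_sum, map_smul, norm_smul] using norm_sum_le s fun i => μ i • g (x i)
    _ ≤ ∑ i ∈ s, C * ‖g (x i)‖ := by gcongr with i hi; exact hC i hi
    _ ≤ 4 * B * C := by rw [← Finset.mul_sum, mul_comm]; gcongr

/-- The bound for the norm of a multiplier of the basis `b` with scalars in the unit ball of `ℓ∞`;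
the factor `4` is what passing from `{0, 1}`-valued scalars to arbitrary ones costs. -/
def multConst (b : UnconditionalSchauderBasis ι 𝕜 Z) : ℝ := 4 * b.nnnormProjBound

lemma multConst_nonneg (b : UnconditionalSchauderBasis ι 𝕜 Z) : 0 ≤ multConst b := by
  unfold multConst; positivity

variable [CompleteSpace Z]

lemma hasSum_smul_coord (b : UnconditionalSchauderBasis ι 𝕜 Z) (μ : ℓ^∞(ι, 𝕜)) (z : Z) :
    HasSum (fun i => μ i • b.coord i z • b i) (∑' i, μ i • b.coord i z • b i) := by
  refine Summable.hasSum (summable_iff_vanishing_norm.2 fun ε hε => ?_)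
  obtain ⟨s, hs⟩ := summable_iff_vanishing_norm.1 (b.expansion z).summable
    (ε / (4 * (‖μ‖ + 1))) (by positivity)
  refine ⟨s, fun t ht => ?_⟩
  calc ‖∑ i ∈ t, μ i • b.coord i z • b i‖
      ≤ 4 * (ε / (4 * (‖μ‖ + 1))) * ‖μ‖ :=
        norm_sum_smul_le (fun i _ => lp.norm_apply_le_norm ENNReal.top_ne_zero μ i)
          (fun u hu => (hs u (ht.mono_left hu)).le) (norm_nonneg μ)
    _ < ε := by
        rw [← mul_div_assoc, div_mul_eq_mul_div, div_lt_iff₀ (by positivity)]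
        nlinarith [norm_nonneg μ]

lemma norm_tsum_smul_coord_le (b : UnconditionalSchauderBasis ι 𝕜 Z) (μ : ℓ^∞(ι, 𝕜)) (z : Z) :
    ‖∑' i, μ i • b.coord i z • b i‖ ≤ multConst b * ‖μ‖ * ‖z‖ := by
  refine le_of_tendsto (hasSum_smul_coord b μ z).norm (Eventually.of_forall fun s => ?_)
  refine (norm_sum_smul_le (fun i _ => lp.norm_apply_le_norm ENNReal.top_ne_zero μ i)
    (B := b.nnnormProjBound * ‖z‖) (fun t _ => ?_) (norm_nonneg μ)).trans_eq
    (by unfold multConst; ring)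
  rw [← b.proj_apply]
  exact (b.proj t).le_of_opNorm_le (b.norm_proj_le_nnnormProjBound t) z

lemma coord_tsum_smul_coord (b : UnconditionalSchauderBasis ι 𝕜 Z) (μ : ℓ^∞(ι, 𝕜)) (z : Z)
    (i : ι) : b.coord i (∑' i, μ i • b.coord i z • b i) = μ i * b.coord i z :=
  coord_eq_of_hasSum (a := fun i => μ i * b.coord i z)
    (by simpa only [mul_smul] using hasSum_smul_coord b μ z) i

/-- The operator which multiplies the coordinates with respect to the basis `b` by bounded scalars;
see `multiplier` for the bundled version. -/
def multiplierCLM (b : UnconditionalSchauderBasis ι 𝕜 Z) (μ : ℓ^∞(ι, 𝕜)) : Z →L[𝕜] Z :=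
  LinearMap.mkContinuous
    { toFun := fun z => ∑' i, μ i • b.coord i z • b i
      map_add' := fun x y => ext_coord (b := b) fun i => by
        simp only [(b.coord i).map_add, coord_tsum_smul_coord, mul_add]
      map_smul' := fun c x => ext_coord (b := b) fun i => by
        rw [coord_tsum_smul_coord, map_smul, map_smul, coord_tsum_smul_coord]
        exact mul_left_comm _ _ _ }
    (multConst b * ‖μ‖) (norm_tsum_smul_coord_le b μ)

lemma coord_multiplierCLM (b : UnconditionalSchauderBasis ι 𝕜 Z) (μ : ℓ^∞(ι, 𝕜)) (z : Z)
    (i : ι) : b.coord i (multiplierCLM b μ z) = μ i * b.coord i z :=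
  coord_tsum_smul_coord b μ z i

/-- The multipliers of the basis `b`, that is, the operators which multiply the coordinates by
bounded scalars, as a representation of the algebra `ℓ∞`. -/
def multiplier (b : UnconditionalSchauderBasis ι 𝕜 Z) : ℓ^∞(ι, 𝕜) →ₐ[𝕜] (Z →L[𝕜] Z) :=
  AlgHom.ofLinearMap
    { toFun := multiplierCLM b
      map_add' := fun μ ν => ContinuousLinearMap.ext fun z => ext_coord (b := b) fun i => by
        simp [coord_multiplierCLM, add_mul]
      map_smul' := fun c μ => ContinuousLinearMap.ext fun z => ext_coord (b := b) fun i => by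
        simp [coord_multiplierCLM, mul_assoc] }
    (ContinuousLinearMap.ext fun z => ext_coord (b := b) fun i => by
      simp [coord_multiplierCLM, lp.infty_coeFn_one])
    (fun μ ν => ContinuousLinearMap.ext fun z => ext_coord (b := b) fun i => by
      simp [coord_multiplierCLM, lp.infty_coeFn_mul, mul_assoc])

variable {b : UnconditionalSchauderBasis ι 𝕜 Z}

@[simp]
lemma coord_multiplier (μ : ℓ^∞(ι, 𝕜)) (z : Z) (i : ι) :
    b.coord i (multiplier b μ z) = μ i * b.coord i z :=
  coord_multiplierCLM b μ z i

lemma norm_multiplier_apply_le (μ : ℓ^∞(ι, 𝕜)) (z : Z) :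
    ‖multiplier b μ z‖ ≤ multConst b * ‖μ‖ * ‖z‖ :=
  norm_tsum_smul_coord_le b μ z

variable (𝕜) in
/-- The indicator function of a set of indices, as an element of `ℓ∞`. -/
def indicatorLp (A : Set ι) : ℓ^∞(ι, 𝕜) :=
  ⟨A.indicator 1, memℓp_infty ⟨1, by
    rintro _ ⟨i, rfl⟩
    exact (norm_indicator_le_norm_self _ _).trans (by simp)⟩⟩

@[simp]
lemma indicatorLp_of_mem {A : Set ι} {i : ι} (h : i ∈ A) : indicatorLp 𝕜 A i = 1 :=
  Set.indicator_of_mem h _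

@[simp]
lemma indicatorLp_of_notMem {A : Set ι} {i : ι} (h : i ∉ A) : indicatorLp 𝕜 A i = 0 :=
  Set.indicator_of_notMem h _

end Multipliers

section UniformNets

lemma totallyBounded_of_forall_exists_dist_le {E : Type*} [PseudoMetricSpace E] {s : Set E}
    (h : ∀ ε > 0, ∃ t, TotallyBounded t ∧ ∀ x ∈ s, ∃ y ∈ t, dist x y ≤ ε) : TotallyBounded s := by
  refine Metric.totallyBounded_iff.2 fun ε hε => ?_
  obtain ⟨t, ht, hst⟩ := h (ε / 2) (by positivity)
  obtain ⟨u, hu, htu⟩ := Metric.totallyBounded_iff.1 ht (ε / 2) (by positivity)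
  refine ⟨u, hu, fun x hx => ?_⟩
  obtain ⟨y, hy, hxy⟩ := hst x hx
  obtain ⟨z, hz, hyz⟩ := mem_iUnion₂.1 (htu hy)
  refine mem_iUnion₂.2 ⟨z, hz, ?_⟩
  rw [Metric.mem_ball] at hyz ⊢
  linarith [dist_triangle x y z]

lemma exists_isOpen_uniform_net {Θ Y W : Type*} [TopologicalSpace Θ] [BaireSpace Θ] [Nonempty Θ]
    [PseudoMetricSpace W] [TopologicalSpace.SeparableSpace W] {φ : Θ → Y → W}
    (hφ : ∀ y, Continuous fun θ => φ θ y) (hTB : ∀ θ, TotallyBounded (range (φ θ)))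
    {δ : ℝ} (hδ : 0 < δ) :
    ∃ U : Set Θ, IsOpen U ∧ U.Nonempty ∧ ∃ t : Set W, t.Finite ∧
      ∀ θ ∈ U, ∀ y, ∃ x ∈ t, dist (φ θ y) x ≤ δ := by
  have : Nonempty Y ∨ IsEmpty Y := (isEmpty_or_nonempty Y).symm
  rcases this with ⟨⟨y₀⟩⟩ | hY
  swap; · exact ⟨univ, isOpen_univ, univ_nonempty, ∅, finite_empty, fun _ _ y => isEmptyElim y⟩
  have : Nonempty W := ⟨φ (Classical.arbitrary Θ) y₀⟩
  let x : ℕ → W := TopologicalSpace.denseSeq W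
  let C : ℕ → Set Θ := fun N => {θ | ∀ y, ∃ n ∈ Finset.range N, dist (φ θ y) (x n) ≤ δ}
  have hclosed (N : ℕ) : IsClosed (C N) := by
    have : C N = ⋂ y, ⋃ n ∈ Finset.range N, {θ | dist (φ θ y) (x n) ≤ δ} := by ext θ; simp [C]
    rw [this]
    exact isClosed_iInter fun y => isClosed_biUnion_finset fun n _ =>
      isClosed_le ((hφ y).dist continuous_const) continuous_const
  have hunion : ⋃ N, C N = univ := by
    refine eq_univ_of_forall fun θ => mem_iUnion.2 ?_
    obtain ⟨c, hc, hcov⟩ := Metric.totallyBounded_iff.1 (hTB θ) (δ / 2) (by positivity)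
    choose n hn using fun w => (TopologicalSpace.denseRange_denseSeq W).exists_dist_lt w
      (half_pos hδ)
    obtain ⟨N, hN⟩ := (hc.image n).bddAbove
    refine ⟨N + 1, fun y => ?_⟩
    obtain ⟨w, hw, hyw⟩ := mem_iUnion₂.1 (hcov (mem_range_self y))
    refine ⟨n w, Finset.mem_range.2 (Nat.lt_succ_of_le (hN (mem_image_of_mem n hw))), ?_⟩
    linarith [dist_triangle (φ θ y) w (x (n w)), Metric.mem_ball.1 hyw, hn w]
  obtain ⟨N, hN⟩ := nonempty_interior_of_iUnion_of_closed hclosed hunion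
  refine ⟨interior (C N), isOpen_interior, hN, x '' Finset.range N,
    (Finset.finite_toSet _).image x, fun θ hθ y => ?_⟩
  obtain ⟨n, hn, hny⟩ := interior_subset hθ y
  exact ⟨x n, mem_image_of_mem x hn, hny⟩

end UniformNets

section Signs

variable {𝕜 : Type*} [RCLike 𝕜] {Z : Type*} [NormedAddCommGroup Z] [NormedSpace 𝕜 Z]
  {W : Type*} [NormedAddCommGroup W] [NormedSpace 𝕜 W] {ι : Type*}

lemma norm_signType_coe_le (s : SignType) : ‖(s : 𝕜)‖ ≤ 1 := by
  cases s <;> simp [SignType.cast]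

variable (𝕜) in
/-- A family of signs as an element of `ℓ∞`. -/
def signLp (θ : ι → SignType) : ℓ^∞(ι, 𝕜) :=
  ⟨fun i => (θ i : 𝕜), memℓp_infty ⟨1, by rintro _ ⟨i, rfl⟩; exact norm_signType_coe_le _⟩⟩

@[simp]
lemma signLp_apply (θ : ι → SignType) (i : ι) : signLp 𝕜 θ i = (θ i : 𝕜) := rfl

lemma norm_signLp_le (θ : ι → SignType) : ‖signLp 𝕜 θ‖ ≤ 1 :=
  lp.norm_le_of_forall_le zero_le_one fun i => norm_signType_coe_le (θ i)

lemma totallyBounded_image_of_isCompactOperator {T : Z →L[𝕜] W} (hT : IsCompactOperator T)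
    {A : Set Z} (hA : Bornology.IsBounded A) : TotallyBounded (T '' A) :=
  (hT.isCompact_closure_image_of_bounded hA).totallyBounded.subset subset_closure

lemma isCompactOperator_of_totallyBounded_image [CompleteSpace W] {T : Z →L[𝕜] W}
    (hT : TotallyBounded (T '' Metric.closedBall 0 1)) : IsCompactOperator T :=
  (isCompactOperator_iff_isCompact_closure_image_closedBall (T : Z →ₗ[𝕜] W) zero_lt_one).2
    (hT.closure.isCompact_of_isClosed isClosed_closure)

lemma isCompactOperator_proj (b : UnconditionalSchauderBasis ι 𝕜 Z) (s : Finset ι) :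
    IsCompactOperator (b.proj s) :=
  (compactOperator (RingHom.id 𝕜) Z Z).sum_mem fun i _ =>
    (isCompactOperator_of_locallyCompactSpace_dom (b.coord i)).clm_comp
      (ContinuousLinearMap.toSpanSingleton 𝕜 (b i))

variable [CompleteSpace Z] {b : UnconditionalSchauderBasis ι 𝕜 Z}

/-- The multiplier of the basis `b` given by a family of signs. As the sign `0` is allowed, the
finite partial sum projections and their sign changes are included. -/
def signMultiplier (b : UnconditionalSchauderBasis ι 𝕜 Z) (θ : ι → SignType) : Z →L[𝕜] Z :=
  multiplier b (signLp 𝕜 θ)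

@[simp]
lemma coord_signMultiplier (θ : ι → SignType) (z : Z) (i : ι) :
    b.coord i (signMultiplier b θ z) = (θ i : 𝕜) * b.coord i z :=
  coord_multiplier _ _ _

lemma norm_signMultiplier_apply_le (θ : ι → SignType) (z : Z) :
    ‖signMultiplier b θ z‖ ≤ multConst b * ‖z‖ := by
  refine (norm_multiplier_apply_le _ z).trans ?_
  gcongr
  exact mul_le_of_le_one_right (multConst_nonneg b) (norm_signLp_le θ)

lemma multiplier_proj (μ : ℓ^∞(ι, 𝕜)) (s : Finset ι) (z : Z) :
    multiplier b μ (b.proj s z) = b.proj s (multiplier b μ z) :=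
  ext_coord (b := b) fun i => by simp only [coord_multiplier, coord_proj, mul_ite, mul_zero]

lemma signMultiplier_proj (θ : ι → SignType) (s : Finset ι) (z : Z) :
    signMultiplier b θ (b.proj s z) = ∑ i ∈ s, (θ i : 𝕜) • b.coord i z • b i := by
  refine (multiplier_proj _ s z).trans ?_
  simp [b.proj_apply, mul_smul]

lemma continuous_signMultiplier_apply (z : Z) : Continuous fun θ => signMultiplier b θ z := by
  have huniform : TendstoUniformly (fun s θ => signMultiplier b θ (b.proj s z))
      (fun θ => signMultiplier b θ z) atTop := by
    refine Metric.tendstoUniformly_iff.2 fun ε hε => ?_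
    filter_upwards [eventually_norm_sub_proj_lt b z
      (show 0 < ε / (multConst b + 1) by have := multConst_nonneg b; positivity)] with s hs θ
    rw [dist_eq_norm, ← map_sub]
    have hc := multConst_nonneg b
    calc ‖signMultiplier b θ (z - b.proj s z)‖
        ≤ multConst b * ‖z - b.proj s z‖ := norm_signMultiplier_apply_le _ _
      _ ≤ multConst b * (ε / (multConst b + 1)) := by gcongr
      _ < ε := by
        rw [← mul_div_assoc, div_lt_iff₀ (by positivity)]
        linarith
  refine huniform.continuous (Frequently.of_forall fun s => ?_)
  simp only [signMultiplier_proj]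
  exact continuous_finsetSum _ fun i _ =>
    ((continuous_of_discreteTopology (f := ((↑) : SignType → 𝕜))).comp
      (continuous_apply i)).smul continuous_const

/-- Pointwise compactness of `T ∘ signMultiplier b θ` is uniform in `θ`: by the Baire category
theorem it is so on a cylinder `θ = θ₀` on `F`, and leaving the cylinder changes the operators by
ones which factor through the finite-dimensional range of `b.proj F`. -/
lemma totallyBounded_iUnion_image_signMultiplier [TopologicalSpace.SeparableSpace W]
    (T : Z →L[𝕜] W) {A : Set Z} (hA : Bornology.IsBounded A)
    (hT : ∀ θ, TotallyBounded ((fun z => T (signMultiplier b θ z)) '' A)) :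
    TotallyBounded (⋃ θ, (fun z => T (signMultiplier b θ z)) '' A) := by
  classical
  refine totallyBounded_of_forall_exists_dist_le fun ε hε => ?_
  obtain ⟨U, hU, ⟨θ₀, hθ₀⟩, t, ht, hUt⟩ := exists_isOpen_uniform_net
    (φ := fun θ (z : A) => T (signMultiplier b θ z))
    (fun z => T.continuous.comp (continuous_signMultiplier_apply z.1))
    (fun θ => by simpa only [image_eq_range] using hT θ) hε
  obtain ⟨F, u, hu, hFU⟩ := isOpen_pi_iff.1 hU θ₀ hθ₀
  obtain ⟨R, hR⟩ := hA.exists_norm_le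
  let K : Set W := T '' (b.proj F '' Metric.closedBall 0 (multConst b * R + multConst b * R))
  have hK : TotallyBounded K :=
    (totallyBounded_image_of_isCompactOperator (isCompactOperator_proj b F)
      Metric.isBounded_closedBall).image T.uniformContinuous
  refine ⟨⋃ x ∈ t, (x + ·) '' K,
    (totallyBounded_biUnion ht).2 fun x _ =>
      hK.image (uniformContinuous_const.add uniformContinuous_id), ?_⟩
  rintro _ ⟨_, ⟨θ, rfl⟩, z, hz, rfl⟩
  let θ' : ι → SignType := F.piecewise θ₀ θ
  have hθ' : θ' ∈ U := hFU fun i hi => by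
    simpa [θ', Finset.mem_coe.1 hi] using (hu i hi).2
  obtain ⟨x, hx, hzx⟩ := hUt θ' hθ' ⟨z, hz⟩
  let d : Z := signMultiplier b θ z - signMultiplier b θ' z
  have hd : ‖d‖ ≤ multConst b * R + multConst b * R := by
    have (η : ι → SignType) : ‖signMultiplier b η z‖ ≤ multConst b * R :=
      (norm_signMultiplier_apply_le η z).trans
        (mul_le_mul_of_nonneg_left (hR z hz) (multConst_nonneg b))
    exact (norm_sub_le _ _).trans (add_le_add (this θ) (this θ'))
  have hdF : b.proj F d = d := ext_coord (b := b) fun i => by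
    rw [coord_proj]
    by_cases hi : i ∈ F <;> simp [d, θ', hi]
  refine ⟨x + T d, mem_biUnion hx ⟨T d, ⟨d, ⟨d, by simpa using hd, hdF⟩, rfl⟩, rfl⟩, ?_⟩
  rw [dist_eq_norm] at hzx ⊢
  convert hzx using 2
  simp only [d, map_sub]
  abel

lemma totallyBounded_iUnion_signMultiplier_image {A : Set Z} (hA : TotallyBounded A) :
    TotallyBounded (⋃ θ, signMultiplier b θ '' A) := by
  refine totallyBounded_of_forall_exists_dist_le fun ε hε => ?_
  have hc := multConst_nonneg b
  obtain ⟨t, ht, hAt⟩ := Metric.totallyBounded_iff.1 hA (ε / (multConst b + 1)) (by positivity)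
  refine ⟨⋃ x ∈ t, range fun θ => signMultiplier b θ x, (totallyBounded_biUnion ht).2 fun x _ =>
    (isCompact_range (continuous_signMultiplier_apply x)).totallyBounded, ?_⟩
  rintro _ ⟨_, ⟨θ, rfl⟩, z, hz, rfl⟩
  obtain ⟨x, hx, hzx⟩ := mem_iUnion₂.1 (hAt hz)
  refine ⟨signMultiplier b θ x, mem_biUnion hx ⟨θ, rfl⟩, ?_⟩
  rw [Metric.mem_ball, dist_eq_norm] at hzx
  rw [dist_eq_norm, ← map_sub]
  calc ‖signMultiplier b θ (z - x)‖ ≤ multConst b * (ε / (multConst b + 1)) :=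
        (norm_signMultiplier_apply_le _ _).trans (by gcongr)
    _ ≤ ε := by
      rw [← mul_div_assoc, div_le_iff₀ (by positivity)]
      linarith

end Signs

section Averaging

variable {𝕜 : Type*} [RCLike 𝕜] {Z : Type*} [NormedAddCommGroup Z] [NormedSpace 𝕜 Z]
  [CompleteSpace Z] {ι : Type*} {b : UnconditionalSchauderBasis ι 𝕜 Z}

/-- The diagonal of the matrix of the operator `R` with respect to the basis `b`. -/
def diagonal (b : UnconditionalSchauderBasis ι 𝕜 Z) (R : Z →L[𝕜] Z) : ℓ^∞(ι, 𝕜) :=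
  ⟨fun i => b.coord i (R (b i)), memℓp_infty ⟨b.nnnormProjBound * ‖R‖, by
    rintro _ ⟨i, rfl⟩
    refine le_of_mul_le_mul_right ?_ (norm_pos_iff.2 (b.linearIndependent.ne_zero i))
    calc ‖b.coord i (R (b i))‖ * ‖b i‖ = ‖b.proj {i} (R (b i))‖ := by simp [norm_smul]
      _ ≤ b.nnnormProjBound * ‖R (b i)‖ :=
        (b.proj {i}).le_of_opNorm_le (b.norm_proj_le_nnnormProjBound _) _
      _ ≤ b.nnnormProjBound * ‖R‖ * ‖b i‖ := by
        rw [mul_assoc]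
        gcongr
        exact R.le_opNorm _⟩⟩

@[simp]
lemma diagonal_apply (R : Z →L[𝕜] Z) (i : ι) : diagonal b R i = b.coord i (R (b i)) := rfl

lemma diagonal_one_sub (b : UnconditionalSchauderBasis ι 𝕜 Z) (R : Z →L[𝕜] Z) :
    diagonal b (1 - R) = 1 - diagonal b R := by
  ext i
  rw [lp.coeFn_sub, lp.infty_coeFn_one]
  simp [coord_self]

open scoped Classical in
lemma sum_powerset_sign_mul_sign {R : Type*} [CommRing R] {G : Finset ι} {i : ι} (hi : i ∈ G)
    (j : ι) :
    ∑ η ∈ G.powerset, (if i ∈ η then -1 else 1 : R) * (if j ∈ η then -1 else 1) =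
      if i = j then 2 ^ G.card else 0 := by
  have hprod (η : Finset ι) : (if i ∈ η then -1 else 1 : R) * (if j ∈ η then -1 else 1) =
      ∏ k ∈ η, (if k = i then -1 else 1) * (if k = j then -1 else 1) := by
    simp only [Finset.prod_mul_distrib, Finset.prod_ite_eq']
  simp only [hprod, ← Finset.prod_one_add]
  split_ifs with hij
  · subst hij
    refine Finset.prod_eq_pow_card fun k _ => ?_
    split_ifs <;> norm_num
  · exact Finset.prod_eq_zero hi (by simp [hij])

open scoped Classical in
/-- The signs which are `-1` on `η`, `1` on `G \ η` and `0` elsewhere. -/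
def finsetSigns (G η : Finset ι) (i : ι) : SignType :=
  if i ∈ G then if i ∈ η then -1 else 1 else 0

open scoped Classical in
lemma finsetSigns_of_mem {G : Finset ι} {i : ι} (hi : i ∈ G) (η : Finset ι) :
    (finsetSigns G η i : 𝕜) = if i ∈ η then -1 else 1 := by
  simp only [finsetSigns, hi, if_true]
  split_ifs <;> simp

lemma finsetSigns_of_notMem {G : Finset ι} {i : ι} (hi : i ∉ G) (η : Finset ι) :
    finsetSigns G η i = 0 := by simp [finsetSigns, hi]

lemma signMultiplier_eq_sum {G : Finset ι} {θ : ι → SignType} (hθ : ∀ i ∉ G, θ i = 0) (z : Z) :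
    signMultiplier b θ z = ∑ i ∈ G, (θ i : 𝕜) • b.coord i z • b i := by
  rw [← signMultiplier_proj]
  refine ext_coord (b := b) fun i => ?_
  rw [coord_signMultiplier, coord_signMultiplier, coord_proj]
  by_cases hi : i ∈ G <;> simp [hi, hθ]

lemma sum_powerset_conj_signMultiplier (b : UnconditionalSchauderBasis ι 𝕜 Z) (R : Z →L[𝕜] Z)
    (G : Finset ι) (z : Z) :
    ∑ η ∈ G.powerset, signMultiplier b (finsetSigns G η)
        (R (signMultiplier b (finsetSigns G η) z)) =
      (2 ^ G.card : 𝕜) • multiplier b (diagonal b R) (b.proj G z) := by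
  classical
  refine ext_coord (b := b) fun i => ?_
  rw [map_sum, map_smul, coord_multiplier, coord_proj]
  simp only [coord_signMultiplier]
  split_ifs with hi
  swap; · simp [finsetSigns_of_notMem hi]
  calc ∑ η ∈ G.powerset, (finsetSigns G η i : 𝕜) *
        b.coord i (R (signMultiplier b (finsetSigns G η) z))
      = ∑ η ∈ G.powerset, ∑ j ∈ G, ((if i ∈ η then -1 else 1) * (if j ∈ η then -1 else 1)) *
          (b.coord j z * b.coord i (R (b j))) := by
        refine Finset.sum_congr rfl fun η _ => ?_
        rw [signMultiplier_eq_sum (G := G) fun j hj => finsetSigns_of_notMem hj η]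
        simp only [map_sum, map_smul, smul_eq_mul, Finset.mul_sum]
        refine Finset.sum_congr rfl fun j hj => ?_
        rw [finsetSigns_of_mem hi, finsetSigns_of_mem hj, mul_assoc]
    _ = 2 ^ G.card • (diagonal b R i * b.coord i z) := by
        rw [Finset.sum_comm]
        simp only [← Finset.sum_mul, sum_powerset_sign_mul_sign hi]
        simp [hi, mul_comm]
    _ = _ := by simp

lemma apply_multiplier_diagonal_mem_closure_convexHull {W : Type*} [NormedAddCommGroup W]
    [NormedSpace 𝕜 W] [NormedSpace ℝ W] [IsScalarTower ℝ 𝕜 W]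
    (b : UnconditionalSchauderBasis ι 𝕜 Z) (R : Z →L[𝕜] Z) (U : Z →L[𝕜] W) (z : Z) :
    U (multiplier b (diagonal b R) z) ∈ closure (convexHull ℝ
      (range fun θ => U (signMultiplier b θ (R (signMultiplier b θ z))))) := by
  have hlim : Tendsto (fun G => U (multiplier b (diagonal b R) (b.proj G z))) atTop
      (𝓝 (U (multiplier b (diagonal b R) z))) := by
    have h := b.tendsto_proj z
    rw [SummationFilter.unconditional_filter] at h
    exact ((U ∘L multiplier b (diagonal b R)).continuous.tendsto z).comp h
  refine mem_closure_of_tendsto hlim (Eventually.of_forall fun G => ?_)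
  have havg : U (multiplier b (diagonal b R) (b.proj G z)) =
      ∑ η ∈ G.powerset, ((2 : ℝ) ^ G.card)⁻¹ •
        U (signMultiplier b (finsetSigns G η) (R (signMultiplier b (finsetSigns G η) z))) := by
    rw [← Finset.smul_sum, ← map_sum, sum_powerset_conj_signMultiplier, map_smul,
      ← algebraMap_smul 𝕜 ((2 : ℝ) ^ G.card)⁻¹, smul_smul, map_inv₀, map_pow, map_ofNat,
      inv_mul_cancel₀ (pow_ne_zero _ two_ne_zero), one_smul]
  rw [havg]
  refine (convex_convexHull ℝ _).sum_mem (fun _ _ => by positivity) ?_ fun η _ =>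
    subset_convexHull ℝ _ ⟨finsetSigns G η, rfl⟩
  rw [Finset.sum_const, Finset.card_powerset, nsmul_eq_mul]
  push_cast
  exact mul_inv_cancel₀ (by positivity)

variable [TopologicalSpace.SeparableSpace Z] {P Q : Z →L[𝕜] Z}

lemma totallyBounded_iUnion_image_closedBall
    (h : ∀ θ, IsCompactOperator (P ∘L signMultiplier b θ ∘L Q)) (r : ℝ) :
    TotallyBounded (⋃ θ, (P ∘L signMultiplier b θ ∘L Q) '' Metric.closedBall 0 r) := by
  have hTB := totallyBounded_iUnion_image_signMultiplier (b := b) P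
    (Q.lipschitz.isBounded_image (Metric.isBounded_closedBall (x := 0) (r := r))) fun θ => by
      rw [image_image]
      exact totallyBounded_image_of_isCompactOperator (h θ) Metric.isBounded_closedBall
  simpa only [image_image, ContinuousLinearMap.coe_comp, Function.comp_def] using hTB

lemma isCompactOperator_comp_multiplier_diagonal_right
    (h : ∀ θ, IsCompactOperator (P ∘L signMultiplier b θ ∘L Q)) :
    IsCompactOperator (P ∘L multiplier b (diagonal b Q)) := by
  let _ : NormedSpace ℝ Z := NormedSpace.restrictScalars ℝ 𝕜 Z
  have : IsScalarTower ℝ 𝕜 Z := RestrictScalars.isScalarTower ℝ 𝕜 Z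
  refine isCompactOperator_of_totallyBounded_image <| TotallyBounded.subset ?_
    (totallyBounded_convexHull.2 (totallyBounded_iUnion_image_closedBall h (multConst b))).closure
  rintro _ ⟨z, hz, rfl⟩
  refine closure_mono (convexHull_mono ?_)
    (apply_multiplier_diagonal_mem_closure_convexHull b Q P z)
  rintro _ ⟨θ, rfl⟩
  refine mem_iUnion.2 ⟨θ, signMultiplier b θ z, ?_, rfl⟩
  rw [mem_closedBall_zero_iff] at hz ⊢
  exact (norm_signMultiplier_apply_le θ z).trans
    (mul_le_of_le_one_right (multConst_nonneg b) hz)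

lemma isCompactOperator_multiplier_diagonal_comp_left
    (h : ∀ θ, IsCompactOperator (P ∘L signMultiplier b θ ∘L Q)) :
    IsCompactOperator (multiplier b (diagonal b P) ∘L Q) := by
  let _ : NormedSpace ℝ Z := NormedSpace.restrictScalars ℝ 𝕜 Z
  have : IsScalarTower ℝ 𝕜 Z := RestrictScalars.isScalarTower ℝ 𝕜 Z
  refine isCompactOperator_of_totallyBounded_image <| TotallyBounded.subset ?_
    (totallyBounded_convexHull.2 (totallyBounded_iUnion_signMultiplier_image (b := b)
      (totallyBounded_iUnion_image_closedBall h 1))).closure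
  rintro _ ⟨z, hz, rfl⟩
  refine closure_mono (convexHull_mono ?_)
    (apply_multiplier_diagonal_mem_closure_convexHull b P (ContinuousLinearMap.id 𝕜 Z) (Q z))
  rintro _ ⟨θ, rfl⟩
  exact mem_iUnion.2 ⟨θ, _, mem_iUnion.2 ⟨θ, z, hz, rfl⟩, rfl⟩

end Averaging

section Complements

variable {𝕜 : Type*} [RCLike 𝕜] {Z : Type*} [NormedAddCommGroup Z] [NormedSpace 𝕜 Z]
  {W : Type*} [NormedAddCommGroup W] [NormedSpace 𝕜 W]

lemma nonempty_equiv_of_isCompl_ker [CompleteSpace Z] [CompleteSpace W] {f : Z →L[𝕜] W}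
    (hf : Function.Surjective f) {U : Submodule 𝕜 Z} (hU : IsClosed (U : Set Z))
    (h : IsCompl U f.ker) : Nonempty (U ≃L[𝕜] W) := by
  have : CompleteSpace U := hU.completeSpace_coe
  refine ⟨ContinuousLinearEquiv.ofBijective (f ∘L U.subtypeL) ?_ ?_⟩
  · refine (Submodule.eq_bot_iff _).2 fun x hx => ?_
    exact Subtype.ext (Submodule.disjoint_def.1 h.disjoint x x.2 (by simpa using hx))
  · refine LinearMap.range_eq_top.2 fun w => ?_
    obtain ⟨z, rfl⟩ := hf w
    obtain ⟨u, hu, k, hk, rfl⟩ := Submodule.mem_sup.1 (h.sup_eq_top ▸ Submodule.mem_top (x := z))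
    exact ⟨⟨u, hu⟩, by simp [show f k = 0 from hk]⟩

lemma codisjoint_range_ker_of_norm_lt_one [CompleteSpace Z] {P S : Z →L[𝕜] Z}
    (hS : IsIdempotentElem S) (h : ‖S * (1 - P)‖ < 1) : Codisjoint P.range S.ker := by
  refine codisjoint_iff.2 (eq_top_iff.2 fun z _ => ?_)
  obtain ⟨y, hy⟩ : ∃ y, (1 - S * (1 - P)) y = S z :=
    ⟨((Units.oneSub _ h)⁻¹ : (Z →L[𝕜] Z)ˣ).1 (S z), by
      simpa using congr($((Units.oneSub _ h).mul_inv) (S z))⟩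
  have hSS (x : Z) : S (S x) = S x := congr($hS.eq x)
  have hyS : y = S (z + (1 - P) y) := by
    rw [map_add, ← hy]
    simp
  have hPy : S (P y) = S z := by
    have hSy : S y = y := by rw [hyS, hSS]
    simpa [hSy] using hy
  exact Submodule.mem_sup.2 ⟨P y, ⟨y, rfl⟩, z - P y, by simp [hPy], by abel⟩

lemma finiteDimensional_range_inf_ker {P S : Z →L[𝕜] Z} (hP : IsIdempotentElem P)
    (h : IsCompactOperator (P ∘L (1 - S))) :
    FiniteDimensional 𝕜 (P.range ⊓ S.ker : Submodule 𝕜 Z) := by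
  have hfix (x : (P.range ⊓ S.ker : Submodule 𝕜 Z)) :
      (P ∘L (1 - S)) (x : Z) = x := by
    have hSx : S x = 0 := x.2.2
    have hPx : P x = x := (LinearMap.IsIdempotentElem.mem_range_iff
      (ContinuousLinearMap.IsIdempotentElem.toLinearMap hP)).1 x.2.1
    simp [hSx, hPx]
  have hclosed : IsClosed ((P.range ⊓ S.ker : Submodule 𝕜 Z) : Set Z) := by
    rw [Submodule.coe_inf]
    exact (ContinuousLinearMap.IsIdempotentElem.isClosed_range hP).inter S.isClosed_ker
  have hcompact := (h.comp_clm (P.range ⊓ S.ker).subtypeL).codRestrict (V := P.range ⊓ S.ker)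
    (fun x => by simpa only [Function.comp_apply, Submodule.subtypeL_apply, hfix] using x.2) hclosed
  refine FiniteDimensional.of_isCompactOperator_id (𝕜 := 𝕜) (Eq.subst ?_ hcompact)
  exact funext fun x => Subtype.ext (hfix x)

end Complements

section SupportedIn

variable {𝕜 : Type*} [RCLike 𝕜] {Z : Type*} [NormedAddCommGroup Z] [NormedSpace 𝕜 Z] {ι : Type*}

/-- The closed subspace of the vectors whose support with respect to the basis `b` is contained
in `A`. -/
def supportedIn (b : UnconditionalSchauderBasis ι 𝕜 Z) (A : Set ι) : Submodule 𝕜 Z :=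
  ⨅ i ∈ Aᶜ, (b.coord i).ker

variable {b : UnconditionalSchauderBasis ι 𝕜 Z} {A B : Set ι}

lemma mem_supportedIn {z : Z} : z ∈ supportedIn b A ↔ ∀ i ∉ A, b.coord i z = 0 := by
  simp [supportedIn]

lemma isClosed_supportedIn (b : UnconditionalSchauderBasis ι 𝕜 Z) (A : Set ι) :
    IsClosed (supportedIn b A : Set Z) := by
  simp only [supportedIn, Submodule.coe_iInf]
  exact isClosed_biInter fun i _ => (b.coord i).isClosed_ker

lemma topologicalClosure_span_image (b : UnconditionalSchauderBasis ι 𝕜 Z) (A : Set ι) :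
    (Submodule.span 𝕜 (b '' A)).topologicalClosure = supportedIn b A := by
  refine le_antisymm (Submodule.topologicalClosure_minimal _ ?_ (isClosed_supportedIn b A))
    fun z hz => ?_
  · rw [Submodule.span_le]
    rintro _ ⟨i, hi, rfl⟩
    exact mem_supportedIn.2 fun j hj => coord_of_ne (ne_of_mem_of_not_mem hi hj).symm
  · have h := b.tendsto_proj z
    rw [SummationFilter.unconditional_filter] at h
    refine mem_closure_of_tendsto h (Eventually.of_forall fun s => ?_)
    rw [b.proj_apply]
    refine Submodule.sum_mem _ fun i _ => ?_
    by_cases hi : i ∈ A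
    · exact Submodule.smul_mem _ _ (Submodule.subset_span ⟨i, hi, rfl⟩)
    · simp [mem_supportedIn.1 hz i hi]

/-- Removing one index lowers the dimension of the intersection with `R`, as long as it is not
zero, without destroying `R ⊔ supportedIn b B = ⊤`. -/
lemma exists_isCompl_supportedIn {R : Submodule 𝕜 Z} (hR : Codisjoint R (supportedIn b B))
    [FiniteDimensional 𝕜 (R ⊓ supportedIn b B : Submodule 𝕜 Z)] :
    ∃ B', IsCompl R (supportedIn b B') := by
  induction h : Module.finrank 𝕜 (R ⊓ supportedIn b B : Submodule 𝕜 Z)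
    using Nat.strong_induction_on generalizing B with
  | _ n ih =>
  by_cases hbot : R ⊓ supportedIn b B = ⊥
  · exact ⟨B, disjoint_iff.2 hbot, hR⟩
  obtain ⟨x, ⟨hxR, hxB⟩, hx⟩ := (Submodule.ne_bot_iff _).1 hbot
  obtain ⟨i, hi⟩ : ∃ i, b.coord i x ≠ 0 := by
    by_contra! hall
    exact hx (ext_coord (b := b) fun i => by simpa using hall i)
  have hlt : R ⊓ supportedIn b (B \ {i}) < R ⊓ supportedIn b B := by
    refine lt_of_le_of_ne (inf_le_inf_left R fun z hz => mem_supportedIn.2 fun j hj =>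
      mem_supportedIn.1 hz j fun h => hj h.1) fun heq => hi ?_
    exact mem_supportedIn.1 (heq.ge ⟨hxR, hxB⟩).2 i fun h => h.2 rfl
  have hcodisjoint : Codisjoint R (supportedIn b (B \ {i})) := by
    refine codisjoint_iff.2 (eq_top_iff.2 (hR.eq_top.ge.trans (sup_le le_sup_left fun z hz => ?_)))
    let a := b.coord i z / b.coord i x
    refine Submodule.mem_sup.2 ⟨a • x, R.smul_mem a hxR, z - a • x,
      mem_supportedIn.2 fun j hj => ?_, by abel⟩
    rcases eq_or_ne j i with rfl | hji
    · simp [a, hi]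
    · have hjB : j ∉ B := fun h => hj ⟨h, hji⟩
      simp [mem_supportedIn.1 hz j hjB, mem_supportedIn.1 hxB j hjB]
  have : FiniteDimensional 𝕜 (R ⊓ supportedIn b (B \ {i}) : Submodule 𝕜 Z) :=
    Submodule.finiteDimensional_of_le hlt.le
  exact ih _ (h ▸ Submodule.finrank_lt_finrank_of_lt hlt) hcodisjoint rfl

variable [CompleteSpace Z]

/-- The projection onto `supportedIn b A` which sets the coordinates outside `A` to zero. -/
def setProj (b : UnconditionalSchauderBasis ι 𝕜 Z) (A : Set ι) : Z →L[𝕜] Z :=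
  multiplier b (indicatorLp 𝕜 A)

@[simp]
lemma coord_setProj_of_mem {i : ι} (hi : i ∈ A) (z : Z) :
    b.coord i (setProj b A z) = b.coord i z := by simp [setProj, hi]

@[simp]
lemma coord_setProj_of_notMem {i : ι} (hi : i ∉ A) (z : Z) :
    b.coord i (setProj b A z) = 0 := by simp [setProj, hi]

lemma setProj_mem (b : UnconditionalSchauderBasis ι 𝕜 Z) (A : Set ι) (z : Z) :
    setProj b A z ∈ supportedIn b A :=
  mem_supportedIn.2 fun _ hi => coord_setProj_of_notMem hi z

lemma setProj_of_mem {z : Z} (hz : z ∈ supportedIn b A) : setProj b A z = z :=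
  ext_coord (b := b) fun i => by
    by_cases hi : i ∈ A
    · simp [hi]
    · simp [hi, mem_supportedIn.1 hz]

lemma isIdempotentElem_setProj (b : UnconditionalSchauderBasis ι 𝕜 Z) (A : Set ι) :
    IsIdempotentElem (setProj b A) :=
  ContinuousLinearMap.ext fun z => setProj_of_mem (setProj_mem b A z)

lemma ker_setProj (b : UnconditionalSchauderBasis ι 𝕜 Z) (A : Set ι) :
    (setProj b A).ker = supportedIn b Aᶜ := by
  ext z
  refine ⟨fun hz => mem_supportedIn.2 fun i hi => ?_, fun hz => ext_coord (b := b) fun i => ?_⟩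
  · rw [← coord_setProj_of_mem (not_not.1 hi), show setProj b A z = 0 from hz, map_zero]
  · rw [map_zero]
    by_cases hi : i ∈ A
    · exact (coord_setProj_of_mem hi z).trans (mem_supportedIn.1 hz i (not_not.2 hi))
    · exact coord_setProj_of_notMem hi z

lemma one_sub_proj_comp_setProj (b : UnconditionalSchauderBasis ι 𝕜 Z) (F : Finset ι)
    (A : Set ι) : (1 - b.proj F) ∘L setProj b A = setProj b (A \ F) := by
  classical
  refine ContinuousLinearMap.ext fun z => ext_coord (b := b) fun i => ?_
  have hproj := coord_proj (b := b) F (setProj b A z) i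
  by_cases hF : i ∈ F <;> by_cases hA : i ∈ A <;> simp_all [-GeneralSchauderBasis.proj_apply]

lemma one_sub_setProj_diff (b : UnconditionalSchauderBasis ι 𝕜 Z) (F : Finset ι) (A : Set ι) :
    1 - setProj b (A \ F) = setProj b Aᶜ + b.proj F ∘L setProj b A := by
  refine ContinuousLinearMap.ext fun z => ext_coord (b := b) fun i => ?_
  rw [← one_sub_proj_comp_setProj]
  by_cases hA : i ∈ A <;> simp [hA, -GeneralSchauderBasis.proj_apply]

end SupportedIn

section Splitting

variable {𝕜 : Type*} [RCLike 𝕜] {Z : Type*} [NormedAddCommGroup Z] [NormedSpace 𝕜 Z]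
  [CompleteSpace Z] {ι : Type*} {b : UnconditionalSchauderBasis ι 𝕜 Z}

lemma exists_mul_eq_indicatorLp {d : ℓ^∞(ι, 𝕜)} {A : Set ι} {c : ℝ} (hc : 0 < c)
    (h : ∀ i ∈ A, c ≤ ‖d i‖) : ∃ l, l * d = indicatorLp 𝕜 A := by
  refine ⟨⟨A.indicator fun i => (d i)⁻¹, memℓp_infty ⟨c⁻¹, ?_⟩⟩, ?_⟩
  · rintro _ ⟨i, rfl⟩
    by_cases hi : i ∈ A
    · simpa [hi] using inv_anti₀ hc (h i hi)
    · simpa [hi] using hc.le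
  · ext i
    rw [lp.infty_coeFn_mul, Pi.mul_apply]
    by_cases hi : i ∈ A
    · simp [hi, inv_mul_cancel₀ (norm_pos_iff.1 (hc.trans_le (h i hi)))]
    · simp [hi]

lemma exists_finset_norm_one_sub_proj_mul_lt (b : UnconditionalSchauderBasis ι 𝕜 Z)
    {K : Z →L[𝕜] Z} (hK : IsCompactOperator K) {ε : ℝ} (hε : 0 < ε) :
    ∃ F : Finset ι, ‖(1 - b.proj F) ∘L K‖ < ε := by
  let C : ℝ := b.nnnormProjBound
  have hC : 0 ≤ C := b.nnnormProjBound.coe_nonneg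
  let δ : ℝ := ε / (2 * (C + 2))
  have hδ : 0 < δ := by positivity
  obtain ⟨t, ht, hKt⟩ := Metric.totallyBounded_iff.1 (totallyBounded_image_of_isCompactOperator hK
    (Metric.isBounded_closedBall (x := 0) (r := 1))) δ hδ
  obtain ⟨F, hF⟩ := ((eventually_all_finite ht).2 fun x _ =>
    eventually_norm_sub_proj_lt b x hδ).exists
  refine ⟨F, (ContinuousLinearMap.opNorm_le_of_unit_norm (by positivity) fun z hz => ?_).trans_lt
    (half_lt_self hε)⟩
  obtain ⟨x, hx, hzx⟩ := mem_iUnion₂.1 (hKt ⟨z, by simp [hz], rfl⟩)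
  rw [Metric.mem_ball, dist_eq_norm] at hzx
  have hproj : ‖b.proj F (x - K z)‖ ≤ C * δ :=
    (b.proj F).le_of_opNorm_le_of_le (b.norm_proj_le_nnnormProjBound F)
      (by rw [norm_sub_rev]; exact hzx.le)
  calc ‖((1 - b.proj F) ∘L K) z‖
      = ‖(K z - x) + (x - b.proj F x) + b.proj F (x - K z)‖ := by
        rw [map_sub]
        congr 1
        simp only [ContinuousLinearMap.comp_apply, sub_apply, one_apply_eq_self]
        abel
    _ ≤ δ + δ + C * δ := norm_add₃_le.trans (by gcongr; exact (hF x hx).le)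
    _ = ε / 2 := by simp only [δ]; field_simp; ring

variable [TopologicalSpace.SeparableSpace Z]

/-- Since `P + (1 - P) = 1`, every index belongs to the large part of `diagonal b P` or to that of
`diagonal b (1 - P)`. -/
lemma exists_isCompl_range_supportedIn {P : Z →L[𝕜] Z} (hP : IsIdempotentElem P)
    (h : ∀ θ, IsCompactOperator (P ∘L signMultiplier b θ ∘L (1 - P))) :
    ∃ A, IsCompl P.range (supportedIn b A) := by
  let N : Set ι := {i | 1 / 2 ≤ ‖diagonal b P i‖}
  obtain ⟨l, hl⟩ := exists_mul_eq_indicatorLp (d := diagonal b P) (A := N) one_half_pos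
    fun i hi => hi
  obtain ⟨r, hr⟩ := exists_mul_eq_indicatorLp (d := diagonal b (1 - P)) (A := Nᶜ) one_half_pos
    fun i hi => by
      have hlt : ‖diagonal b P i‖ < 1 / 2 := not_le.1 hi
      rw [diagonal_one_sub, lp.coeFn_sub, lp.infty_coeFn_one]
      have hle := norm_sub_norm_le (1 : 𝕜) (diagonal b P i)
      rw [norm_one] at hle
      exact le_trans (by linarith) hle
  have hN : IsCompactOperator (setProj b N ∘L (1 - P)) := by
    rw [setProj, ← hl, map_mul]
    exact (isCompactOperator_multiplier_diagonal_comp_left h).clm_comp (multiplier b l)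
  have hNc : IsCompactOperator (P ∘L setProj b Nᶜ) := by
    rw [setProj, ← hr, mul_comm, map_mul]
    exact (isCompactOperator_comp_multiplier_diagonal_right h).comp_clm (multiplier b r)
  obtain ⟨F, hF⟩ := exists_finset_norm_one_sub_proj_mul_lt b hN one_pos
  rw [← ContinuousLinearMap.comp_assoc, one_sub_proj_comp_setProj] at hF
  have hcodisjoint := codisjoint_range_ker_of_norm_lt_one (isIdempotentElem_setProj b (N \ F))
    (P := P) hF
  have hfinite := finiteDimensional_range_inf_ker hP (S := setProj b (N \ F)) (by
    rw [one_sub_setProj_diff, ContinuousLinearMap.comp_add]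
    exact hNc.add (((isCompactOperator_proj b F).comp_clm (setProj b N)).clm_comp P))
  rw [ker_setProj] at hcodisjoint hfinite
  exact exists_isCompl_supportedIn hcodisjoint

variable {X Y : Type*} [NormedAddCommGroup X] [NormedSpace 𝕜 X] [CompleteSpace X]
  [NormedAddCommGroup Y] [NormedSpace 𝕜 Y] [CompleteSpace Y]

lemma exists_splitting_of_isCompactOperator (b : UnconditionalSchauderBasis ι 𝕜 Z)
    (e : Z ≃L[𝕜] X × Y) (h : ∀ T : Y →L[𝕜] X, IsCompactOperator T) :
    ∃ A, Nonempty (supportedIn b A ≃L[𝕜] X) ∧ Nonempty (supportedIn b Aᶜ ≃L[𝕜] Y) := by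
  let p : Z →L[𝕜] X := ContinuousLinearMap.fst 𝕜 X Y ∘L e
  let q : Z →L[𝕜] Y := ContinuousLinearMap.snd 𝕜 X Y ∘L e
  let jX : X →L[𝕜] Z := e.symm ∘L ContinuousLinearMap.inl 𝕜 X Y
  let jY : Y →L[𝕜] Z := e.symm ∘L ContinuousLinearMap.inr 𝕜 X Y
  let P : Z →L[𝕜] Z := jX ∘L p
  have hpj (x : X) : p (jX x) = x := by simp [p, jX]
  have hP : IsIdempotentElem P := ContinuousLinearMap.ext fun z => congrArg jX (hpj (p z))
  have hP' := ContinuousLinearMap.IsIdempotentElem.toLinearMap hP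
  have hPQ : 1 - P = jY ∘L q := ContinuousLinearMap.ext fun z => e.injective (by
    ext <;> simp [P, p, q, jX, jY])
  have hq : Function.Surjective q := Prod.snd_surjective.comp e.surjective
  have hp : Function.Surjective p := Prod.fst_surjective.comp e.surjective
  have hker_p : P.ker = p.ker := by ext z; simp [P, p, jX]
  have hker_q : P.range = q.ker := by
    rw [LinearMap.IsIdempotentElem.range_eq_ker_one_sub hP']
    ext z
    change (1 - P) z = 0 ↔ q z = 0
    rw [hPQ]
    simp [jY]
  obtain ⟨B, hB⟩ := exists_isCompl_range_supportedIn (b := b) hP fun θ => by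
    rw [hPQ]
    exact ((h (p ∘L signMultiplier b θ ∘L jY)).comp_clm q).clm_comp jX
  rw [hker_q] at hB
  have hX : IsCompl q.ker p.ker := by
    rw [← hker_p, ← hker_q]
    exact LinearMap.IsIdempotentElem.isCompl hP'
  have hY := nonempty_equiv_of_isCompl_ker hq (isClosed_supportedIn b B) hB.symm
  obtain ⟨eX⟩ := nonempty_equiv_of_isCompl_ker hp q.isClosed_ker hX
  have hproj : Function.Surjective ((setProj b Bᶜ).codRestrict _ (setProj_mem b Bᶜ)) :=
    fun z => ⟨z, Subtype.ext (setProj_of_mem z.2)⟩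
  have : CompleteSpace (supportedIn b Bᶜ) := (isClosed_supportedIn b Bᶜ).completeSpace_coe
  obtain ⟨eB⟩ := nonempty_equiv_of_isCompl_ker hproj q.isClosed_ker (by
    rwa [ContinuousLinearMap.ker_codRestrict, ker_setProj, compl_compl])
  exact ⟨Bᶜ, ⟨eB.symm.trans eX⟩, by rwa [compl_compl]⟩

end Splitting

section RestrictBasis

/-- A subspace of a subspace, as a subspace of the whole space. -/
def submoduleOfEquivL {𝕜 Z : Type*} [RCLike 𝕜] [NormedAddCommGroup Z] [NormedSpace 𝕜 Z]
    {U V : Submodule 𝕜 Z} (h : U ≤ V) : U.submoduleOf V ≃L[𝕜] U where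
  toLinearEquiv := Submodule.submoduleOfEquivOfLe h
  continuous_toFun := by fun_prop
  continuous_invFun := by fun_prop

variable {𝕜 : Type*} [RCLike 𝕜] {Z : Type*} [NormedAddCommGroup Z] [NormedSpace 𝕜 Z] {ι : Type*}

/-- The subfamily of the basis `b` with indices in `A`, as a basis of its closed linear span. -/
def restrictBasis (b : UnconditionalSchauderBasis ι 𝕜 Z) (A : Set ι) :
    UnconditionalSchauderBasis A 𝕜 (supportedIn b A) where
  basis i := ⟨b i, mem_supportedIn.2 fun _ hj => coord_of_ne (ne_of_mem_of_not_mem i.2 hj).symm⟩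
  coord i := b.coord i ∘L (supportedIn b A).subtypeL
  ortho i j := by
    classical
    change b.coord i (b j) = _
    rw [b.ortho]
    simp only [Pi.single_apply, Subtype.ext_iff]
  expansion x := by
    have hsupp : Function.support (fun i => b.coord i (x : Z) • b i) ⊆ A := fun i hi => by
      by_contra hiA
      exact hi (by simp [mem_supportedIn.1 x.2 i hiA])
    have h := (hasSum_subtype_iff_of_support_subset hsupp).2 (b.expansion (x : Z))
    exact (IsInducing.hasSum_iff (g := (supportedIn b A).subtype) IsInducing.subtypeVal _ _).1 h

variable {b : UnconditionalSchauderBasis ι 𝕜 Z} {A : Set ι} {B : Set A}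

lemma supportedIn_mono {A B : Set ι} (h : A ⊆ B) : supportedIn b A ≤ supportedIn b B :=
  fun _ hz => mem_supportedIn.2 fun i hi => mem_supportedIn.1 hz i fun hA => hi (h hA)

lemma supportedIn_restrictBasis : supportedIn (restrictBasis b A) B =
    (supportedIn b (Subtype.val '' B)).submoduleOf (supportedIn b A) := by
  ext x
  rw [mem_supportedIn, Submodule.submoduleOf, Submodule.mem_comap, mem_supportedIn]
  refine ⟨fun h i hi => ?_, fun h i hi => h i (by simpa using hi)⟩
  by_cases hA : i ∈ A
  · exact h ⟨i, hA⟩ fun hB => hi ⟨_, hB, rfl⟩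
  · exact mem_supportedIn.1 x.2 i hA

/-- The vectors supported in `B ⊆ A` form the same space, whether the support is taken with respect
to the restricted basis or to the original one. -/
def supportedInRestrictBasisEquiv (b : UnconditionalSchauderBasis ι 𝕜 Z) (A : Set ι) (B : Set A) :
    supportedIn (restrictBasis b A) B ≃L[𝕜] supportedIn b (Subtype.val '' B) :=
  (ContinuousLinearEquiv.ofEq _ _ supportedIn_restrictBasis).trans
    (submoduleOfEquivL (supportedIn_mono (Subtype.coe_image_subset A B)))

end RestrictBasis

section FiniteSums

variable {𝕜 : Type*} [RCLike 𝕜]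

lemma isCompactOperator_of_pi {J : Type*} [Finite J] {X : J → Type*}
    [∀ j, NormedAddCommGroup (X j)] [∀ j, NormedSpace 𝕜 (X j)] {W : Type*} [NormedAddCommGroup W]
    [NormedSpace 𝕜 W] (hc : ∀ j, ∀ T : X j →L[𝕜] W, IsCompactOperator T)
    (T : (∀ j, X j) →L[𝕜] W) : IsCompactOperator T := by
  classical
  have := Fintype.ofFinite J
  have hT : T = ∑ j, (T ∘L ContinuousLinearMap.single 𝕜 X j) ∘L ContinuousLinearMap.proj j :=
    ContinuousLinearMap.ext fun x => by
      simpa using congrArg T (Finset.univ_sum_single x).symm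
  have h : T ∈ compactOperator (RingHom.id 𝕜) (∀ j, X j) W := by
    rw [hT]
    exact Submodule.sum_mem _ fun j _ =>
      (hc j (T ∘L ContinuousLinearMap.single 𝕜 X j)).comp_clm (ContinuousLinearMap.proj j)
  exact h

lemma exists_splitting_pi_of_isCompactOperator {n : ℕ} {X : Fin n → Type*}
    [∀ j, NormedAddCommGroup (X j)] [∀ j, NormedSpace 𝕜 (X j)] [∀ j, CompleteSpace (X j)]
    (hc : ∀ j k, j < k → ∀ T : X k →L[𝕜] X j, IsCompactOperator T)
    {Z : Type*} [NormedAddCommGroup Z] [NormedSpace 𝕜 Z] {ι : Type*} [Countable ι]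
    (b : UnconditionalSchauderBasis ι 𝕜 Z) (e : Z ≃L[𝕜] ∀ j, X j) :
    ∃ σ : ι → Fin n, ∀ j, Nonempty (supportedIn b {i | σ i = j} ≃L[𝕜] X j) := by
  classical
  induction n generalizing Z ι with
  | zero =>
    have : Subsingleton Z := e.injective.subsingleton
    have : IsEmpty ι := ⟨fun i => b.linearIndependent.ne_zero i (Subsingleton.elim _ _)⟩
    exact ⟨isEmptyElim, isEmptyElim⟩
  | succ n ih =>
    have := separableSpace_of_basis b
    have : CompleteSpace Z :=
      (completeSpace_congr (e := e.toEquiv) e.isUniformEmbedding).2 inferInstance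
    obtain ⟨A, ⟨e₀⟩, ⟨e₁⟩⟩ := exists_splitting_of_isCompactOperator b
      (e.trans (Fin.consEquivL 𝕜 X).symm) (isCompactOperator_of_pi fun j => hc 0 j.succ j.succ_pos)
    obtain ⟨τ, hτ⟩ := ih (fun j k hjk => hc j.succ k.succ (Fin.succ_lt_succ_iff.2 hjk))
      (restrictBasis b Aᶜ) e₁
    let σ (i : ι) : Fin (n + 1) := if h : i ∈ A then 0 else (τ ⟨i, h⟩).succ
    have hσ₀ : {i | σ i = 0} = A := by
      ext i
      by_cases h : i ∈ A <;> simp [σ, h, Fin.succ_ne_zero]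
    have hσ (k : Fin n) : {i | σ i = k.succ} = Subtype.val '' {i : (Aᶜ : Set ι) | τ i = k} := by
      ext i
      by_cases h : i ∈ A
      · simp [σ, h, (Fin.succ_ne_zero k).symm]
      · simp [σ, h]
    refine ⟨σ, Fin.cases (hσ₀ ▸ ⟨e₀⟩) fun k => ?_⟩
    obtain ⟨eₖ⟩ := hτ k
    rw [hσ]
    exact ⟨(supportedInRestrictBasisEquiv b Aᶜ _).symm.trans eₖ⟩

theorem splittingForUnconditionalBases_of_isCompactOperator {n : ℕ} {X : Fin n → Type*}
    [∀ j, NormedAddCommGroup (X j)] [∀ j, NormedSpace 𝕜 (X j)] [∀ j, CompleteSpace (X j)]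
    (hc : ∀ j k, j < k → ∀ T : X k →L[𝕜] X j, IsCompactOperator T) :
    SplittingForUnconditionalBases 𝕜 X := by
  intro ι _ b
  obtain ⟨σ, hσ⟩ := exists_splitting_pi_of_isCompactOperator hc b (ContinuousLinearEquiv.refl 𝕜 _)
  exact ⟨σ, fun j => topologicalClosure_span_image b _ ▸ hσ j⟩

end FiniteSums

section MapBasis

variable {𝕜 : Type*} [RCLike 𝕜] {Z : Type*} [NormedAddCommGroup Z] [NormedSpace 𝕜 Z]
  {W : Type*} [NormedAddCommGroup W] [NormedSpace 𝕜 W] {ι : Type*}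

/-- The image of a basis under an isomorphism. -/
def mapBasis (b : UnconditionalSchauderBasis ι 𝕜 Z) (e : Z ≃L[𝕜] W) :
    UnconditionalSchauderBasis ι 𝕜 W where
  basis i := e (b i)
  coord i := b.coord i ∘L (e.symm : W →L[𝕜] Z)
  ortho i j := by simp [b.ortho]
  expansion x := by simpa using (e : Z →L[𝕜] W).hasSum (b.expansion (e.symm x))

variable {b : UnconditionalSchauderBasis ι 𝕜 Z}

lemma SemiNormalized.map (h : SemiNormalized b) (e : Z ≃L[𝕜] W) :
    SemiNormalized (mapBasis b e) := by
  obtain ⟨c, C, hc, hb⟩ := h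
  refine ⟨c / (‖(e.symm : W →L[𝕜] Z)‖ + 1), ‖(e : Z →L[𝕜] W)‖ * C, by positivity, fun i => ⟨?_, ?_⟩⟩
  · rw [div_le_iff₀' (by positivity)]
    calc c ≤ ‖e.symm (e (b i))‖ := by simpa using (hb i).1
      _ ≤ ‖(e.symm : W →L[𝕜] Z)‖ * ‖e (b i)‖ := (e.symm : W →L[𝕜] Z).le_opNorm _
      _ ≤ (‖(e.symm : W →L[𝕜] Z)‖ + 1) * ‖e (b i)‖ := by gcongr; simp
  · exact (e : Z →L[𝕜] W).le_opNorm_of_le (hb i).2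

lemma SemiNormalized.restrict (h : SemiNormalized b) (A : Set ι) :
    SemiNormalized (restrictBasis b A) := by
  obtain ⟨c, C, hc, hb⟩ := h
  exact ⟨c, C, hc, fun i => hb i⟩

end MapBasis

section PiBasis

variable {𝕜 : Type*} [RCLike 𝕜] {J : Type*} [Fintype J] {X : J → Type*}
  [∀ j, NormedAddCommGroup (X j)] [∀ j, NormedSpace 𝕜 (X j)] {ι : J → Type*}

open scoped Classical in
/-- The direct sum of bases. -/
def piBasis (b : ∀ j, UnconditionalSchauderBasis (ι j) 𝕜 (X j)) :
    UnconditionalSchauderBasis (Σ j, ι j) 𝕜 (∀ j, X j) where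
  basis p := Pi.single p.1 (b p.1 p.2)
  coord p := (b p.1).coord p.2 ∘L ContinuousLinearMap.proj p.1
  ortho := by
    rintro ⟨j, i⟩ ⟨k, l⟩
    rcases eq_or_ne j k with rfl | hjk
    · simp [(b j).ortho, Pi.single_apply]
    · simp [hjk]
  expansion x := by
    refine Pi.hasSum.2 fun k => ((sigma_mk_injective (i := k)).hasSum_iff ?_).1 ?_
    · rintro ⟨j, i⟩ h
      have hkj : k ≠ j := by
        rintro rfl
        exact h ⟨i, rfl⟩
      simp [Pi.single_eq_of_ne hkj]
    · simpa [Function.comp_def] using (b k).expansion (x k)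

lemma SemiNormalized.pi {b : ∀ j, UnconditionalSchauderBasis (ι j) 𝕜 (X j)}
    (h : ∀ j, SemiNormalized (b j)) : SemiNormalized (piBasis b) := by
  classical
  choose c C hc hb using h
  obtain ⟨c₀, hc₀, hle⟩ : ∃ c₀ : ℝ, 0 < c₀ ∧ ∀ j, c₀ ≤ c j := by
    rcases isEmpty_or_nonempty J with _ | _
    · exact ⟨1, one_pos, isEmptyElim⟩
    · obtain ⟨j, hj⟩ := Finite.exists_min c
      exact ⟨c j, hc j, hj⟩
  obtain ⟨C₀, hC₀⟩ := (Set.finite_range C).bddAbove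
  refine ⟨c₀, C₀, hc₀, fun p => ?_⟩
  rw [show ‖piBasis b p‖ = ‖b p.1 p.2‖ from Pi.norm_single _]
  exact ⟨(hle _).trans (hb p.1 p.2).1, (hb p.1 p.2).2.trans (hC₀ (mem_range_self _))⟩

end PiBasis

section Partition

variable {𝕜 : Type*} [RCLike 𝕜] {J : Type*} [Fintype J] {Z : Type*} [NormedAddCommGroup Z]
  [NormedSpace 𝕜 Z] {κ : Type*}

lemma coord_sum_supportedIn {b : UnconditionalSchauderBasis κ 𝕜 Z} {σ : κ → J}
    (x : ∀ j, supportedIn b {i | σ i = j}) (i : κ) :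
    b.coord i (∑ j, (x j : Z)) = b.coord i (x (σ i)) := by
  rw [map_sum]
  exact Finset.sum_eq_single_of_mem (σ i) (Finset.mem_univ _) fun j _ hj =>
    mem_supportedIn.1 (x j).2 i hj.symm

variable [CompleteSpace Z]

/-- A partition of a basis into finitely many parts decomposes the space into the direct sum of the
closed linear spans of the parts. -/
def partitionEquiv (b : UnconditionalSchauderBasis κ 𝕜 Z) (σ : κ → J) :
    (∀ j, supportedIn b {i | σ i = j}) ≃L[𝕜] Z where
  toFun x := ∑ j, (x j : Z)
  invFun z j := ⟨setProj b {i | σ i = j} z, setProj_mem b _ z⟩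
  map_add' x y := by simp [Finset.sum_add_distrib]
  map_smul' c x := by simp [Finset.smul_sum]
  left_inv x := funext fun j => Subtype.ext <| ext_coord (b := b) fun i => by
    rcases eq_or_ne (σ i) j with rfl | hi
    · exact (coord_setProj_of_mem (A := {k | σ k = σ i}) rfl _).trans (coord_sum_supportedIn x i)
    · exact (coord_setProj_of_notMem (A := {k | σ k = j}) hi _).trans
        (mem_supportedIn.1 (x j).2 i hi).symm
  right_inv z := ext_coord (b := b) fun i =>
    (coord_sum_supportedIn (fun j => ⟨setProj b {i | σ i = j} z, setProj_mem b _ z⟩) i).trans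
      (coord_setProj_of_mem (A := {k | σ k = σ i}) rfl z)
  continuous_toFun := by fun_prop
  continuous_invFun := by fun_prop

lemma partitionEquiv_single [DecidableEq J] (b : UnconditionalSchauderBasis κ 𝕜 Z) (σ : κ → J)
    (j : J) (x : supportedIn b {i | σ i = j}) : partitionEquiv b σ (Pi.single j x) = x := by
  refine (Finset.sum_eq_single_of_mem j (Finset.mem_univ j) fun k _ hk => ?_).trans ?_
  · simp [Pi.single_eq_of_ne hk]
  · simp

end Partition

theorem hasUTAPBasis_pi {𝕜 : Type*} [RCLike 𝕜] {J : Type} [Fintype J] {X : J → Type*}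
    [∀ j, NormedAddCommGroup (X j)] [∀ j, NormedSpace 𝕜 (X j)] [∀ j, CompleteSpace (X j)]
    (hs : SplittingForUnconditionalBases 𝕜 X) (h : ∀ j, HasUTAPBasis 𝕜 (X j)) :
    HasUTAPBasis 𝕜 (∀ j, X j) := by
  classical
  choose ι hι b hb hunique using h
  refine ⟨Σ j, ι j, inferInstance, piBasis b, SemiNormalized.pi hb, fun κ _ b' hb' => ?_⟩
  obtain ⟨σ, hσ⟩ := hs κ inferInstance b'
  have e (j : J) : supportedIn b' {i | σ i = j} ≃L[𝕜] X j :=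
    (topologicalClosure_span_image b' {i | σ i = j} ▸ hσ j).some
  choose π T hT using fun j => hunique j {i | σ i = j} inferInstance
    (mapBasis (restrictBasis b' _) (e j)) ((hb'.restrict _).map (e j))
  let V (j : J) : X j ≃L[𝕜] supportedIn b' {i | σ i = j} := (T j).trans (e j).symm
  have hV (j : J) (i : ι j) : V j (b j i) = restrictBasis b' _ (π j i) := by
    rw [ContinuousLinearEquiv.trans_apply, hT]
    exact (e j).symm_apply_apply _
  refine ⟨(Equiv.sigmaCongrRight π).trans (Equiv.sigmaFiberEquiv σ),
    (ContinuousLinearEquiv.piCongrRight V).trans (partitionEquiv b' σ), fun ⟨j, i⟩ => ?_⟩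
  have hsingle : ContinuousLinearEquiv.piCongrRight V (piBasis b ⟨j, i⟩)
      = Pi.single j (V j (b j i)) :=
    funext fun k => Pi.apply_single (fun k => V k) (fun k => map_zero (V k)) j (b j i) k
  rw [ContinuousLinearEquiv.trans_apply, hsingle, partitionEquiv_single, hV]
  rfl

section SequenceNorms

variable {E F κ : Type*} [NormedAddCommGroup E] [NormedAddCommGroup F] {q r : ℝ≥0∞}
  {s : Finset κ} {f : κ → E} {g : κ → F}

/-- The `ℓ_q`-norm of the restriction of a family to a finite set of indices. -/
def lqNorm (q : ℝ≥0∞) (s : Finset κ) (f : κ → E) : ℝ :=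
  if q = ∞ then (s.sup fun k => ‖f k‖₊ : NNReal) else (∑ k ∈ s, ‖f k‖ ^ q.toReal) ^ (1 / q.toReal)

lemma lqNorm_top (s : Finset κ) (f : κ → E) : lqNorm ∞ s f = (s.sup fun k => ‖f k‖₊ : NNReal) :=
  if_pos rfl

lemma lqNorm_of_ne_top (hq : q ≠ ∞) (s : Finset κ) (f : κ → E) :
    lqNorm q s f = (∑ k ∈ s, ‖f k‖ ^ q.toReal) ^ (1 / q.toReal) :=
  if_neg hq

lemma lqNorm_nonneg : 0 ≤ lqNorm q s f := by
  unfold lqNorm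
  split_ifs <;> positivity

lemma lqNorm_map {ι : Type*} (e : κ ↪ ι) (f : ι → E) :
    lqNorm q (s.map e) f = lqNorm q s (f ∘ e) := by
  simp [lqNorm, Finset.sup_map, Function.comp_def]

lemma norm_le_lqNorm (hq : 0 < q) {k : κ} (hk : k ∈ s) : ‖f k‖ ≤ lqNorm q s f := by
  rcases eq_or_ne q ∞ with rfl | htop
  · rw [lqNorm_top]
    exact_mod_cast Finset.le_sup (f := fun k => ‖f k‖₊) hk
  · have hp := ENNReal.toReal_pos hq.ne' htop
    rw [lqNorm_of_ne_top htop, one_div, Real.le_rpow_inv_iff_of_pos (norm_nonneg _)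
      (by positivity) hp]
    exact Finset.single_le_sum (f := fun k => ‖f k‖ ^ q.toReal) (fun _ _ => by positivity) hk

lemma lqNorm_le_mul_lqNorm (hq : 0 < q) {c : ℝ} (hc : 0 ≤ c) (h : ∀ k ∈ s, ‖f k‖ ≤ c * ‖g k‖) :
    lqNorm q s f ≤ c * lqNorm q s g := by
  rcases eq_or_ne q ∞ with rfl | htop
  · lift c to NNReal using hc
    simp only [lqNorm_top]
    norm_cast
    refine Finset.sup_le fun k hk => (show ‖f k‖₊ ≤ c * ‖g k‖₊ from h k hk).trans ?_
    gcongr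
    exact Finset.le_sup (f := fun k => ‖g k‖₊) hk
  · have hp := ENNReal.toReal_pos hq.ne' htop
    simp only [lqNorm_of_ne_top htop]
    calc (∑ k ∈ s, ‖f k‖ ^ q.toReal) ^ (1 / q.toReal)
        ≤ (∑ k ∈ s, (c * ‖g k‖) ^ q.toReal) ^ (1 / q.toReal) := by
          gcongr with k hk
          exact h k hk
      _ = (c ^ q.toReal * ∑ k ∈ s, ‖g k‖ ^ q.toReal) ^ (1 / q.toReal) := by
          simp only [Real.mul_rpow hc (norm_nonneg _), Finset.mul_sum]
      _ = c * (∑ k ∈ s, ‖g k‖ ^ q.toReal) ^ (1 / q.toReal) := by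
          rw [Real.mul_rpow (by positivity) (by positivity), one_div, Real.rpow_rpow_inv hc hp.ne']

lemma norm_toLp_comp_equivFin_symm (hq : 0 < q) (s : Finset κ) (f : κ → E) :
    ‖(WithLp.toLp q (fun i => f (s.equivFin.symm i)) : PiLp q fun _ : Fin s.card => E)‖
      = lqNorm q s f := by
  rcases eq_or_ne q ∞ with rfl | htop
  · rw [lqNorm_top, ← Finset.sup_attach, ← coe_nnnorm, PiLp.nnnorm_eq_ciSup,
      ← Finset.univ_eq_attach, Finset.sup_univ_eq_ciSup]
    exact congrArg _ (s.equivFin.symm.iSup_comp (g := fun k : s => ‖f k‖₊))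
  · rw [lqNorm_of_ne_top htop, PiLp.norm_eq_sum (ENNReal.toReal_pos hq.ne' htop)]
    congr 1
    exact (s.equivFin.symm.sum_comp fun k : s => ‖f k‖ ^ q.toReal).trans
      (s.sum_coe_sort fun k => ‖f k‖ ^ q.toReal)

lemma lqNorm_one {𝕜 : Type*} [RCLike 𝕜] {m : ℕ} (hm : 0 < m) :
    lqNorm q (Finset.range m) (fun _ => (1 : 𝕜)) = (m : ℝ) ^ (1 / q.toReal) := by
  rcases eq_or_ne q ∞ with rfl | htop
  · simp [lqNorm_top, Finset.sup_const (Finset.nonempty_range_iff.2 hm.ne')]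
  · simp [lqNorm_of_ne_top htop]

end SequenceNorms

section Domination

variable {𝕜 : Type*} [RCLike 𝕜] {X : Type*} [NormedAddCommGroup X] [NormedSpace 𝕜 X]
  {Y : Type*} [NormedAddCommGroup Y] [NormedSpace 𝕜 Y] {κ : Type*} {q r : ℝ≥0∞}

variable (𝕜) in
/-- The family `f` dominates the unit vector basis of `ℓ_q`: finite linear combinations of `f` are
bounded below by the `ℓ_q`-norms of their coefficients. -/
def DominatesLq (q : ℝ≥0∞) (f : κ → X) : Prop :=
  ∃ c > 0, ∀ (s : Finset κ) (a : κ → 𝕜), c * lqNorm q s a ≤ ‖∑ k ∈ s, a k • f k‖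

variable (𝕜) in
/-- The family `f` is dominated by the unit vector basis of `ℓ_q`: finite linear combinations of
`f` are bounded above by the `ℓ_q`-norms of their coefficients. -/
def DominatedByLq (q : ℝ≥0∞) (f : κ → X) : Prop :=
  ∃ C ≥ 0, ∀ (s : Finset κ) (a : κ → 𝕜), ‖∑ k ∈ s, a k • f k‖ ≤ C * lqNorm q s a

lemma norm_sum_smul_map_le (T : Y →L[𝕜] X) (f : κ → Y) (s : Finset κ) (a : κ → 𝕜) :
    ‖∑ k ∈ s, a k • T (f k)‖ ≤ ‖T‖ * ‖∑ k ∈ s, a k • f k‖ := by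
  simpa only [map_sum, map_smul] using T.le_opNorm (∑ k ∈ s, a k • f k)

lemma DominatesLq.of_map {T : Y →L[𝕜] X} {f : κ → Y} (h : DominatesLq 𝕜 q fun k => T (f k)) :
    DominatesLq 𝕜 q f := by
  obtain ⟨c, hc, hcf⟩ := h
  refine ⟨c / (‖T‖ + 1), by positivity, fun s a => ?_⟩
  rw [div_mul_eq_mul_div, div_le_iff₀' (by positivity)]
  calc c * lqNorm q s a ≤ ‖T‖ * ‖∑ k ∈ s, a k • f k‖ :=
        (hcf s a).trans (norm_sum_smul_map_le T f s a)
    _ ≤ (‖T‖ + 1) * ‖∑ k ∈ s, a k • f k‖ := by gcongr; linarith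

lemma DominatedByLq.map (T : Y →L[𝕜] X) {f : κ → Y} (h : DominatedByLq 𝕜 q f) :
    DominatedByLq 𝕜 q fun k => T (f k) := by
  obtain ⟨C, hC, hCf⟩ := h
  refine ⟨‖T‖ * C, by positivity, fun s a => ?_⟩
  calc ‖∑ k ∈ s, a k • T (f k)‖ ≤ ‖T‖ * ‖∑ k ∈ s, a k • f k‖ := norm_sum_smul_map_le T f s a
    _ ≤ ‖T‖ * (C * lqNorm q s a) := by gcongr; exact hCf s a
    _ = ‖T‖ * C * lqNorm q s a := (mul_assoc _ _ _).symm

lemma DominatesLq.eq_of_dominatedByLq {f : ℕ → X} (hq : 0 < q) (hqr : q ≤ r)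
    (hf : DominatesLq 𝕜 q f) (hf' : DominatedByLq 𝕜 r f) : q = r := by
  by_contra hne
  have hlt : q < r := lt_of_le_of_ne hqr hne
  have hp := ENNReal.toReal_pos hq.ne' hlt.ne_top
  have hexp : 1 / r.toReal < 1 / q.toReal := by
    rcases eq_or_ne r ∞ with rfl | hr
    · simpa using hp
    · exact one_div_lt_one_div_of_lt hp ((ENNReal.toReal_lt_toReal hlt.ne_top hr).2 hlt)
  obtain ⟨c, hc, hcf⟩ := hf
  obtain ⟨C, -, hCf⟩ := hf'
  have hgrowth : Tendsto (fun m : ℕ => (m : ℝ) ^ (1 / q.toReal - 1 / r.toReal)) atTop atTop :=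
    (tendsto_rpow_atTop (sub_pos.2 hexp)).comp tendsto_natCast_atTop_atTop
  obtain ⟨m, hm, hm₀⟩ := ((hgrowth.eventually_gt_atTop (C / c)).and (eventually_gt_atTop 0)).exists
  have hle := (hcf (Finset.range m) fun _ => 1).trans (hCf (Finset.range m) fun _ => 1)
  rw [lqNorm_one hm₀, lqNorm_one hm₀] at hle
  have hm' : (0 : ℝ) < m := by exact_mod_cast hm₀
  rw [Real.rpow_sub hm', div_lt_div_iff₀ hc (by positivity)] at hm
  linarith

/-- The tails of `f` and `g` differ by less than the constant with which `g` dominates. -/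
lemma DominatesLq.exists_tail {f g : ℕ → X} (hq : 0 < q) (hg : DominatesLq 𝕜 q g)
    (hfg : Summable fun n => ‖f n - g n‖) : ∃ N, DominatesLq 𝕜 q fun n => f (n + N) := by
  obtain ⟨c, hc, hcg⟩ := hg
  obtain ⟨t, ht⟩ := summable_iff_vanishing_norm.1 hfg (c / 2) (by positivity)
  obtain ⟨N, hN⟩ := t.exists_nat_subset_range
  refine ⟨N, c / 2, by positivity, fun s a => ?_⟩
  have hsmall : ∑ k ∈ s, ‖f (k + N) - g (k + N)‖ ≤ c / 2 := by
    have hdisj : Disjoint (s.map (addRightEmbedding N)) t := by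
      refine Finset.disjoint_left.2 fun k hk hkt => ?_
      obtain ⟨i, -, rfl⟩ := Finset.mem_map.1 hk
      have := Finset.mem_range.1 (hN hkt)
      simp at this
    simpa [abs_of_nonneg, Finset.sum_nonneg] using (le_abs_self _).trans (ht _ hdisj).le
  have hdiff : ‖∑ k ∈ s, a k • g (k + N) - ∑ k ∈ s, a k • f (k + N)‖ ≤ lqNorm q s a * (c / 2) := by
    rw [← Finset.sum_sub_distrib]
    calc ‖∑ k ∈ s, (a k • g (k + N) - a k • f (k + N))‖
        ≤ ∑ k ∈ s, lqNorm q s a * ‖f (k + N) - g (k + N)‖ := norm_sum_le_of_le _ fun k hk => by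
          rw [← smul_sub, norm_smul, norm_sub_rev]
          gcongr
          exact norm_le_lqNorm hq hk
      _ ≤ lqNorm q s a * (c / 2) := by
          rw [← Finset.mul_sum]
          exact mul_le_mul_of_nonneg_left hsmall lqNorm_nonneg
  have hlow : c * lqNorm q s a ≤ ‖∑ k ∈ s, a k • g (k + N)‖ := by
    simpa [lqNorm_map, Function.comp_def]
      using hcg (s.map (addRightEmbedding N)) fun k => a (k - N)
  linarith [norm_le_norm_add_norm_sub' (∑ k ∈ s, a k • g (k + N)) (∑ k ∈ s, a k • f (k + N))]

end Domination

section Embedding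

variable {𝕜 : Type*} [RCLike 𝕜] {X : Type*} [NormedAddCommGroup X] [NormedSpace 𝕜 X] {κ : Type*}
  {q : ℝ≥0∞}

lemma DominatedByLq.summable [CompleteSpace X] {f : κ → X} (hf : DominatedByLq 𝕜 q f) {a : κ → 𝕜}
    (ha : ∀ ε > 0, ∃ s : Finset κ, ∀ t, Disjoint t s → lqNorm q t a < ε) :
    Summable fun k => a k • f k := by
  obtain ⟨C, hC, hCf⟩ := hf
  refine summable_iff_vanishing_norm.2 fun ε hε => ?_
  obtain ⟨s, hs⟩ := ha (ε / (C + 1)) (by positivity)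
  refine ⟨s, fun t ht => ?_⟩
  calc ‖∑ k ∈ t, a k • f k‖ ≤ C * (ε / (C + 1)) := (hCf t a).trans (by gcongr; exact (hs t ht).le)
    _ < ε := by
      rw [← mul_div_assoc, div_lt_iff₀ (by positivity)]
      linarith

/-- The two assumptions on `a ↦ J a` say that the finitely supported families are dense in `V`, and
that the norm of `V` is the `ℓ_q`-norm. Nothing is assumed of this norm, since it is not subadditive
on `ℓ_q` for `q < 1`. -/
lemma exists_embedding_of_dominatesLq [CompleteSpace X] {V : Type*} [AddCommGroup V] [Module 𝕜 V]
    [Norm V] {J : V →ₗ[𝕜] κ → 𝕜}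
    (hJ : ∀ a, ∀ ε > 0, ∃ s : Finset κ, ∀ t, Disjoint t s → lqNorm q t (J a) < ε)
    (hnorm : ∀ a, Tendsto (fun s => lqNorm q s (J a)) atTop (𝓝 ‖a‖))
    {f : κ → X} (hf : DominatesLq 𝕜 q f) (hf' : DominatedByLq 𝕜 q f) :
    ∃ (T : V →ₗ[𝕜] X) (c C : ℝ), 0 < c ∧ ∀ a, c * ‖a‖ ≤ ‖T a‖ ∧ ‖T a‖ ≤ C * ‖a‖ := by
  have hsum (a : V) : Summable fun k => J a k • f k := hf'.summable (hJ a)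
  obtain ⟨c, hc, hcf⟩ := hf
  obtain ⟨C, -, hCf⟩ := hf'
  refine ⟨{ toFun := fun a => ∑' k, J a k • f k
            map_add' := fun a b => by simp [← (hsum a).tsum_add (hsum b), add_smul]
            map_smul' := fun x a => by simp [← (hsum a).tsum_const_smul, mul_smul] },
    c, C, hc, fun a => ?_⟩
  have hlim := (hsum a).hasSum.norm
  exact ⟨le_of_tendsto_of_tendsto' ((hnorm a).const_mul c) hlim fun s => hcf s _,
    le_of_tendsto_of_tendsto' hlim ((hnorm a).const_mul C) fun s => hCf s _⟩

lemma exists_forall_disjoint_lqNorm_lt_of_memℓp (hq : 0 < q) (htop : q ≠ ∞) {a : κ → 𝕜}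
    (ha : Memℓp a q) {ε : ℝ} (hε : 0 < ε) :
    ∃ s : Finset κ, ∀ t, Disjoint t s → lqNorm q t a < ε := by
  have hp := ENNReal.toReal_pos hq.ne' htop
  obtain ⟨s, hs⟩ := summable_iff_vanishing_norm.1 (ha.summable hp) (ε ^ q.toReal) (by positivity)
  refine ⟨s, fun t ht => ?_⟩
  rw [lqNorm_of_ne_top htop, one_div, Real.rpow_inv_lt_iff_of_pos (by positivity) hε.le hp]
  exact (le_abs_self _).trans_lt (hs t ht)

lemma tendsto_lqNorm_lp (hq : 0 < q) (htop : q ≠ ∞) (a : lp (fun _ : κ => 𝕜) q) :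
    Tendsto (fun s => lqNorm q s a) atTop (𝓝 ‖a‖) := by
  have hp := ENNReal.toReal_pos hq.ne' htop
  simp only [lp.norm_eq_tsum_rpow hp, lqNorm_of_ne_top htop]
  exact ((lp.memℓp a).summable hp).hasSum.rpow_const (Or.inr (by positivity))

lemma exists_forall_disjoint_lqNorm_top_lt {a : κ → 𝕜} (ha : Tendsto a cofinite (𝓝 0)) {ε : ℝ}
    (hε : 0 < ε) : ∃ s : Finset κ, ∀ t, Disjoint t s → lqNorm ∞ t a < ε := by
  have hfin : {k | ¬ ‖a k‖ < ε}.Finite := by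
    simpa using ha.norm.eventually_lt_const (by simpa using hε)
  refine ⟨hfin.toFinset, fun t ht => ?_⟩
  lift ε to NNReal using hε.le
  rw [lqNorm_top, NNReal.coe_lt_coe, Finset.sup_lt_iff (by exact_mod_cast hε)]
  intro k hk
  by_contra h
  exact Finset.disjoint_left.1 ht hk (hfin.mem_toFinset.2 h)

lemma tendsto_lqNorm_zeroAtInfty [TopologicalSpace κ] (a : ZeroAtInftyContinuousMap κ 𝕜) :
    Tendsto (fun s => lqNorm ∞ s a) atTop (𝓝 ‖a‖) := by
  refine tendsto_atTop_isLUB (fun s t hst => ?_) ⟨?_, fun B hB => ?_⟩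
  · simp only [lqNorm_top]
    exact_mod_cast Finset.sup_mono hst
  · rintro _ ⟨s, rfl⟩
    simp only [lqNorm_top]
    exact_mod_cast Finset.sup_le (a := ‖a‖₊) fun k _ => a.toBCF.norm_coe_le_norm k
  · have hB₀ : 0 ≤ B := lqNorm_nonneg.trans (hB ⟨∅, rfl⟩)
    exact (BoundedContinuousFunction.norm_le hB₀).2 fun k =>
      (norm_le_lqNorm ENNReal.zero_lt_top (Finset.mem_singleton_self k)).trans (hB ⟨{k}, rfl⟩)

lemma containsLq_of_dominatesLq [CompleteSpace X] (hq : 0 < q) {f : ℕ → X}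
    (hf : DominatesLq 𝕜 q f) (hf' : DominatedByLq 𝕜 q f) : ContainsLq 𝕜 X q := by
  rcases eq_or_ne q ∞ with rfl | htop
  · have hzero (a : ZeroAtInftyContinuousMap ℕ 𝕜) : Tendsto a cofinite (𝓝 0) := by
      rw [← cocompact_eq_cofinite]
      exact a.zero_at_infty'
    exact Or.inr ⟨rfl, exists_embedding_of_dominatesLq
      (J := { toFun := (⇑), map_add' := fun _ _ => rfl, map_smul' := fun _ _ => rfl })
      (fun a _ => exists_forall_disjoint_lqNorm_top_lt (hzero a)) tendsto_lqNorm_zeroAtInfty hf hf'⟩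
  · exact Or.inl ⟨htop, exists_embedding_of_dominatesLq (J := LinearMap.pi (lp.evalₗ _ _))
      (fun a _ => exists_forall_disjoint_lqNorm_lt_of_memℓp hq htop (lp.memℓp a))
      (tendsto_lqNorm_lp hq htop) hf hf'⟩

end Embedding

section DisjointFamilies

variable {𝕜 : Type*} [RCLike 𝕜] {X : Type*} [NormedAddCommGroup X] [NormedSpace 𝕜 X]
  {ι κ : Type*} {b : UnconditionalSchauderBasis ι 𝕜 X} {q : ℝ≥0∞}

lemma supp_smul_subset (a : 𝕜) (x : X) : supp b (a • x) ⊆ supp b x := fun i hi h => hi <| by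
  rw [map_smul, h, smul_zero]

lemma supp_basis_subset (i : ι) : supp b (b i) ⊆ {i} := fun _ hj => by
  by_contra h
  exact hj (coord_of_ne h)

lemma supp_proj_subset (s : Finset ι) (x : X) : supp b (b.proj s x) ⊆ s := fun i hi => by
  by_contra h
  exact hi (by rw [coord_proj, if_neg (mt Finset.mem_coe.2 h)])

lemma pairwise_disjoint_supp_proj {s : κ → Finset ι} (hs : Pairwise (Disjoint on s)) (x : κ → X) :
    Pairwise (Disjoint on fun k => supp b (b.proj (s k) (x k))) := fun _ _ h =>
  (Finset.disjoint_coe.2 (hs h)).mono (supp_proj_subset _ _) (supp_proj_subset _ _)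

lemma disjointlySupported_smul_comp_equivFin_symm {f : κ → X}
    (hf : Pairwise (Disjoint on fun k => supp b (f k))) (a : κ → 𝕜) (s : Finset κ) :
    DisjointlySupported b fun i => a (s.equivFin.symm i) • f (s.equivFin.symm i) := fun _ _ h =>
  (hf ((Subtype.val_injective.comp s.equivFin.symm.injective).ne h)).mono
    (supp_smul_subset _ _) (supp_smul_subset _ _)

lemma sum_comp_equivFin_symm (s : Finset κ) (f : κ → X) :
    ∑ i, f (s.equivFin.symm i) = ∑ k ∈ s, f k :=
  (s.equivFin.symm.sum_comp fun k : s => f k).trans (s.sum_coe_sort f)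

lemma LowerEstimate.dominatesLq (h : LowerEstimate b q) (hq : 0 < q) {f : κ → X}
    (hf : Pairwise (Disjoint on fun k => supp b (f k))) {δ : ℝ} (hδ : 0 < δ)
    (hfδ : ∀ k, δ ≤ ‖f k‖) : DominatesLq 𝕜 q f := by
  obtain ⟨C, hC⟩ := h
  refine ⟨δ / (|C| + 1), by positivity, fun s a => ?_⟩
  have hs := hC s.card _ (disjointlySupported_smul_comp_equivFin_symm hf a s)
  rw [norm_toLp_comp_equivFin_symm hq s fun k => a k • f k,
    sum_comp_equivFin_symm s fun k => a k • f k] at hs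
  have ha : lqNorm q s a ≤ δ⁻¹ * lqNorm q s fun k => a k • f k :=
    lqNorm_le_mul_lqNorm hq (by positivity) fun k _ => by
      rw [norm_smul, ← div_eq_inv_mul, le_div_iff₀ hδ]
      gcongr
      exact hfδ k
  rw [← div_eq_inv_mul, le_div_iff₀' hδ] at ha
  rw [div_mul_eq_mul_div, div_le_iff₀' (by positivity)]
  refine ha.trans (hs.trans ?_)
  gcongr
  linarith [le_abs_self C]

lemma UpperEstimate.dominatedByLq (h : UpperEstimate b q) (hq : 0 < q) {f : κ → X}
    (hf : Pairwise (Disjoint on fun k => supp b (f k))) {D : ℝ} (hD : 0 ≤ D)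
    (hfD : ∀ k, ‖f k‖ ≤ D) : DominatedByLq 𝕜 q f := by
  obtain ⟨C, hC⟩ := h
  refine ⟨|C| * D, by positivity, fun s a => ?_⟩
  have hs := hC s.card _ (disjointlySupported_smul_comp_equivFin_symm hf a s)
  rw [norm_toLp_comp_equivFin_symm hq s fun k => a k • f k,
    sum_comp_equivFin_symm s fun k => a k • f k] at hs
  have ha : lqNorm q s (fun k => a k • f k) ≤ D * lqNorm q s a :=
    lqNorm_le_mul_lqNorm hq hD fun k _ => by
      rw [norm_smul, mul_comm]
      gcongr
      exact hfD k
  calc ‖∑ k ∈ s, a k • f k‖ ≤ C * lqNorm q s (fun k => a k • f k) := hs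
    _ ≤ |C| * (D * lqNorm q s a) := by gcongr; exacts [lqNorm_nonneg, le_abs_self C]
    _ = |C| * D * lqNorm q s a := (mul_assoc _ _ _).symm

lemma infinite_of_not_finiteDimensional (b : UnconditionalSchauderBasis ι 𝕜 X)
    (hX : ¬ FiniteDimensional 𝕜 X) : Infinite ι := by
  by_contra hfin
  have : Finite ι := not_infinite_iff_finite.1 hfin
  refine hX (.of_injective (LinearMap.pi fun i => (b.coord i).toLinearMap) ?_)
  exact fun x y h => ext_coord (b := b) fun i => congrFun h i

lemma containsLq_of_estimates [CompleteSpace X] (hq : 0 < q) (hX : ¬ FiniteDimensional 𝕜 X)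
    (hlow : LowerEstimate b q) (hup : UpperEstimate b q) : ContainsLq 𝕜 X q := by
  have := infinite_of_not_finiteDimensional b hX
  let e := Infinite.natEmbedding ι
  let f : ℕ → X := fun n => (‖b (e n)‖⁻¹ : 𝕜) • b (e n)
  have hnorm (n : ℕ) : ‖f n‖ = 1 := norm_smul_inv_norm fun h => by
    simpa [h] using coord_self (b := b) (e n)
  have hdisj : Pairwise (Disjoint on fun n => supp b (f n)) := fun m n hmn =>
    (disjoint_singleton.2 (e.injective.ne hmn)).mono
      ((supp_smul_subset _ _).trans (supp_basis_subset _))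
      ((supp_smul_subset _ _).trans (supp_basis_subset _))
  exact containsLq_of_dominatesLq hq
    (hlow.dominatesLq hq hdisj one_pos fun n => (hnorm n).ge)
    (hup.dominatedByLq hq hdisj zero_le_one fun n => (hnorm n).le)

end DisjointFamilies

section GlidingHump

variable {𝕜 : Type*} [RCLike 𝕜] {X : Type*} [NormedAddCommGroup X] [NormedSpace 𝕜 X]
  {Y : Type*} [NormedAddCommGroup Y] [NormedSpace 𝕜 Y] {ι κ : Type*}

lemma exists_separated_of_not_isCompactOperator [CompleteSpace X] {T : Y →L[𝕜] X}
    (hT : ¬ IsCompactOperator T) :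
    ∃ δ > 0, ∃ y : ℕ → Y, (∀ n, ‖y n‖ ≤ 1) ∧ ∀ m n, m < n → δ ≤ ‖T (y n) - T (y m)‖ := by
  have hnot := mt isCompactOperator_of_totallyBounded_image hT
  rw [Metric.totallyBounded_iff] at hnot
  push Not at hnot
  obtain ⟨δ, hδ, h⟩ := hnot
  obtain ⟨y, hy, hsep⟩ := exists_seq_of_forall_finset_exists (fun y : Y => ‖y‖ ≤ 1)
    (fun x y => δ ≤ ‖T y - T x‖) fun s _ => by
      obtain ⟨_, ⟨y, hy, rfl⟩, hys⟩ := not_subset.1 (h (T '' s) (s.finite_toSet.image _))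
      refine ⟨y, by simpa using hy, fun x hx => ?_⟩
      by_contra hlt
      refine hys (mem_iUnion₂.2 ⟨T x, mem_image_of_mem _ hx, ?_⟩)
      rw [Metric.mem_ball, dist_eq_norm]
      exact not_le.1 hlt
  exact ⟨δ, hδ, y, hy, hsep⟩

lemma exists_null_sequence_of_not_isCompactOperator [CompleteSpace X] [Countable κ]
    {T : Y →L[𝕜] X} (hT : ¬ IsCompactOperator T) (ψ : κ → StrongDual 𝕜 Y) :
    ∃ δ > 0, ∃ d : ℕ → Y, (∀ n, ‖d n‖ ≤ 2) ∧ (∀ n, δ ≤ ‖T (d n)‖) ∧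
      ∀ i, Tendsto (fun n => ψ i (d n)) atTop (𝓝 0) := by
  obtain ⟨δ, hδ, y, hy, hsep⟩ := exists_separated_of_not_isCompactOperator hT
  have hK : IsCompact (univ.pi fun i => Metric.closedBall (0 : 𝕜) ‖ψ i‖) :=
    isCompact_univ_pi fun i => isCompact_closedBall _ _
  obtain ⟨a, -, φ, hφ, hlim⟩ := hK.tendsto_subseq (x := fun n i => ψ i (y n)) fun n i _ => by
    rw [mem_closedBall_zero_iff]
    exact ((ψ i).le_opNorm _).trans (mul_le_of_le_one_right (norm_nonneg _) (hy n))
  refine ⟨δ, hδ, fun n => y (φ (n + 1)) - y (φ n), fun n => ?_, fun n => ?_, fun i => ?_⟩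
  · linarith [norm_sub_le (y (φ (n + 1))) (y (φ n)), hy (φ (n + 1)), hy (φ n)]
  · rw [map_sub]
    exact hsep _ _ (hφ (Nat.lt_succ_self n))
  · have hi := tendsto_pi_nhds.1 hlim i
    simpa [comp_def] using (hi.comp (tendsto_add_atTop_nat 1)).sub hi

lemma eventually_exists_disjoint_norm_sub_proj_lt (b : UnconditionalSchauderBasis ι 𝕜 X)
    {d : ℕ → X} (hd : ∀ i, Tendsto (fun n => b.coord i (d n)) atTop (𝓝 0)) (s : Finset ι) {ε : ℝ}
    (hε : 0 < ε) : ∀ᶠ n in atTop, ∃ t : Finset ι, Disjoint s t ∧ ‖d n - b.proj t (d n)‖ < ε := by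
  classical
  have hproj : Tendsto (fun n => b.proj s (d n)) atTop (𝓝 0) := by
    simpa [b.proj_apply] using tendsto_finsetSum s fun i _ => (hd i).smul_const (b i)
  filter_upwards [hproj.norm.eventually_lt_const (show ‖(0 : X)‖ < ε / 2 by simpa)] with n hn
  obtain ⟨t, ht, hst⟩ := ((eventually_norm_sub_proj_lt b (d n) (half_pos hε)).and
    (eventually_ge_atTop s)).exists
  refine ⟨t \ s, Finset.disjoint_sdiff, ?_⟩
  have hsplit : b.proj (t \ s) (d n) + b.proj s (d n) = b.proj t (d n) := by
    simpa only [b.proj_apply] using Finset.sum_sdiff hst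
  calc ‖d n - b.proj (t \ s) (d n)‖ = ‖(d n - b.proj t (d n)) + b.proj s (d n)‖ := by
        rw [← hsplit]
        congr 1
        abel
    _ < ε := by linarith [norm_add_le (d n - b.proj t (d n)) (b.proj s (d n))]

/-- In the recursive construction it is the *previous* index that controls the error, which is why
the sequence obtained from it is shifted by one. -/
lemma exists_subseq_norm_sub_proj_le (b : UnconditionalSchauderBasis ι 𝕜 X) {d : ℕ → X}
    (hd : ∀ i, Tendsto (fun n => b.coord i (d n)) atTop (𝓝 0)) {ε : ℝ} (hε : 0 < ε) :
    ∃ (φ : ℕ → ℕ) (s : ℕ → Finset ι), StrictMono φ ∧ Pairwise (Disjoint on s) ∧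
      ∀ n, ‖d (φ n) - b.proj (s n) (d (φ n))‖ ≤ ε * (1 / 2) ^ n := by
  classical
  obtain ⟨p, -, hp⟩ := exists_seq_of_forall_finset_exists (α := ℕ × Finset ι) (fun _ => True)
    (fun p p' => p.1 < p'.1 ∧ Disjoint p.2 p'.2 ∧
      ‖d p'.1 - b.proj p'.2 (d p'.1)‖ ≤ ε * (1 / 2) ^ p.1) fun A _ => by
    obtain ⟨n, ⟨t, ht, htn⟩, hn⟩ := ((eventually_exists_disjoint_norm_sub_proj_lt b hd
      (A.biUnion Prod.snd) (ε := ε * (1 / 2) ^ A.sup Prod.fst) (by positivity)).and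
      (eventually_gt_atTop (A.sup Prod.fst))).exists
    refine ⟨(n, t), trivial, fun p hp => ?_⟩
    have hpA : p.1 ≤ A.sup Prod.fst := Finset.le_sup hp
    refine ⟨hpA.trans_lt hn, ht.mono_left (Finset.subset_biUnion_of_mem Prod.snd hp),
      htn.le.trans ?_⟩
    gcongr ε * ?_
    exact pow_le_pow_of_le_one (by norm_num) (by norm_num) hpA
  have hmono : StrictMono fun n => (p n).1 := fun m n h => (hp m n h).1
  refine ⟨fun n => (p (n + 1)).1, fun n => (p (n + 1)).2, fun m n h => hmono (by omega), ?_,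
    fun n => (hp n (n + 1) n.lt_succ_self).2.2.trans ?_⟩
  · exact (pairwise_disjoint_on _).2 fun m n h => (hp _ _ (by omega)).2.1
  · gcongr ε * ?_
    exact pow_le_pow_of_le_one (by norm_num) (by norm_num) hmono.le_apply

lemma exists_disjoint_sequences_of_not_isCompactOperator [CompleteSpace X] [Countable ι]
    [Countable κ] (bX : UnconditionalSchauderBasis ι 𝕜 X) (bY : UnconditionalSchauderBasis κ 𝕜 Y)
    {T : Y →L[𝕜] X} (hT : ¬ IsCompactOperator T) :
    ∃ (f : ℕ → Y) (g : ℕ → X),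
      Pairwise (Disjoint on fun n => supp bY (f n)) ∧ (∀ n, ‖f n‖ ≤ 3) ∧
      Pairwise (Disjoint on fun n => supp bX (g n)) ∧ (∃ δ > 0, ∀ n, δ ≤ ‖g n‖) ∧
      Summable fun n => ‖T (f n) - g n‖ := by
  obtain ⟨δ, hδ, d, hd, hTd, hnull⟩ := exists_null_sequence_of_not_isCompactOperator hT
    (Sum.elim (fun i => bX.coord i ∘L T) bY.coord)
  obtain ⟨φ, s, hφ, hs, hds⟩ :=
    exists_subseq_norm_sub_proj_le bY (fun i => hnull (Sum.inr i)) one_pos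
  obtain ⟨ψ, t, hψ, ht, hdt⟩ := exists_subseq_norm_sub_proj_le bX (d := fun n => T (d (φ n)))
    (fun i => (hnull (Sum.inl i)).comp hφ.tendsto_atTop) (half_pos hδ)
  let y : ℕ → Y := fun n => d (φ (ψ n))
  have hy (n : ℕ) : ‖y n - bY.proj (s (ψ n)) (y n)‖ ≤ (1 / 2) ^ n := (hds (ψ n)).trans <| by
    rw [one_mul]
    exact pow_le_pow_of_le_one (by norm_num) (by norm_num) hψ.le_apply
  have hpow (n : ℕ) : (1 / 2 : ℝ) ^ n ≤ 1 := pow_le_one₀ (by norm_num) (by norm_num)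
  refine ⟨fun n => bY.proj (s (ψ n)) (y n), fun n => bX.proj (t n) (T (y n)),
    pairwise_disjoint_supp_proj (hs.comp_of_injective hψ.injective) _, fun n => ?_,
    pairwise_disjoint_supp_proj ht _, ⟨δ / 2, half_pos hδ, fun n => ?_⟩, ?_⟩
  · linarith [norm_le_norm_add_norm_sub (y n) (bY.proj (s (ψ n)) (y n)), hd (φ (ψ n)), hy n, hpow n]
  · have := mul_le_of_le_one_right (half_pos hδ).le (hpow n)
    linarith [norm_le_norm_add_norm_sub' (T (y n)) (bX.proj (t n) (T (y n))), hdt n,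
      hTd (φ (ψ n))]
  · refine .of_nonneg_of_le (fun _ => norm_nonneg _) (fun n => ?_)
      (summable_geometric_two.mul_left (‖T‖ + δ / 2))
    calc ‖T (bY.proj (s (ψ n)) (y n)) - bX.proj (t n) (T (y n))‖
        = ‖(T (y n) - bX.proj (t n) (T (y n))) - T (y n - bY.proj (s (ψ n)) (y n))‖ := by
          rw [map_sub]
          congr 1
          abel
      _ ≤ δ / 2 * (1 / 2) ^ n + ‖T‖ * (1 / 2) ^ n :=
          (norm_sub_le _ _).trans (add_le_add (hdt n) (T.le_opNorm_of_le (hy n)))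
      _ = (‖T‖ + δ / 2) * (1 / 2) ^ n := by ring

lemma exists_dominated_sequence_of_not_isCompactOperator [CompleteSpace X] [Countable ι]
    [Countable κ] {bX : UnconditionalSchauderBasis ι 𝕜 X} {bY : UnconditionalSchauderBasis κ 𝕜 Y}
    {q r : ℝ≥0∞} (hq : 0 < q) (hr : 0 < r) (hX : LowerEstimate bX q) (hY : UpperEstimate bY r)
    {T : Y →L[𝕜] X} (hT : ¬ IsCompactOperator T) :
    ∃ f : ℕ → Y, DominatedByLq 𝕜 r f ∧ DominatesLq 𝕜 q fun n => T (f n) := by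
  obtain ⟨f, g, hf, hf₃, hg, ⟨δ, hδ, hgδ⟩, hfg⟩ :=
    exists_disjoint_sequences_of_not_isCompactOperator bX bY hT
  obtain ⟨N, hN⟩ := (hX.dominatesLq hq hg hδ hgδ).exists_tail hq hfg
  exact ⟨fun n => f (n + N), hY.dominatedByLq hr
    (hf.comp_of_injective (add_left_injective N)) zero_le_three fun n => hf₃ (n + N), hN⟩

end GlidingHump

section LatticeEstimateDisjoint

variable {𝕜 : Type*} [RCLike 𝕜]

lemma eq_and_containsLq_of_not_isCompactOperator {X Y : Type*} [NormedAddCommGroup X]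
    [NormedSpace 𝕜 X] [CompleteSpace X] [NormedAddCommGroup Y] [NormedSpace 𝕜 Y] [CompleteSpace Y]
    {ι κ : Type*} [Countable ι] [Countable κ] {bX : UnconditionalSchauderBasis ι 𝕜 X}
    {bY : UnconditionalSchauderBasis κ 𝕜 Y} {q r : ℝ≥0∞} (hq : 0 < q) (hqr : q ≤ r)
    (hX : LowerEstimate bX q) (hY : UpperEstimate bY r) {T : Y →L[𝕜] X}
    (hT : ¬ IsCompactOperator T) : q = r ∧ ContainsLq 𝕜 X q ∧ ContainsLq 𝕜 Y q := by
  obtain ⟨f, hf, hTf⟩ :=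
    exists_dominated_sequence_of_not_isCompactOperator hq (hq.trans_le hqr) hX hY hT
  obtain rfl : q = r := hTf.eq_of_dominatedByLq hq hqr (hf.map T)
  exact ⟨rfl, containsLq_of_dominatesLq hq hTf (hf.map T),
    containsLq_of_dominatesLq hq hTf.of_map hf⟩

lemma isCompactOperator_of_latticeEstimateDisjoint {n : ℕ} {X : Fin (n + 1) → Type*}
    [∀ j, NormedAddCommGroup (X j)] [∀ j, NormedSpace 𝕜 (X j)] [∀ j, CompleteSpace (X j)]
    {ι : Fin (n + 1) → Type*} [∀ j, Countable (ι j)]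
    (hX : ∀ j, j ≠ 0 → j ≠ Fin.last n → ¬ FiniteDimensional 𝕜 (X j))
    {B : ∀ j, UnconditionalSchauderBasis (ι j) 𝕜 (X j)} (hB : LatticeEstimateDisjoint B)
    (j k : Fin (n + 1)) (hjk : j < k) (T : X k →L[𝕜] X j) : IsCompactOperator T := by
  obtain ⟨q, hq, hmono, hest⟩ := hB
  obtain ⟨j, rfl⟩ := Fin.exists_castSucc_eq.2 (Fin.ne_last_of_lt hjk)
  obtain ⟨k, rfl⟩ := Fin.exists_succ_eq.2 (Fin.ne_zero_of_lt hjk)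
  have hjk' : j ≤ k := Fin.castSucc_lt_succ_iff.1 hjk
  by_contra hT
  obtain ⟨hqjk, hXj, hXk⟩ := eq_and_containsLq_of_not_isCompactOperator (hq j) (hmono hjk')
    (hest j).1 (hest k).2.1 hT
  have hnot : ¬ ContainsLq 𝕜 (X j.succ) (q j) := (hest j).2.2.resolve_left (not_not_intro hXj)
  rcases hjk'.eq_or_lt with rfl | hlt
  · exact hnot hXk
  obtain ⟨i, hi⟩ := Fin.exists_castSucc_eq.2 (Fin.ne_last_of_lt (Fin.succ_lt_succ_iff.2 hlt))
  have hji : j ≤ i := Fin.castSucc_le_castSucc_iff.1 (hi ▸ Fin.castSucc_lt_succ.le)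
  have hik : i ≤ k := Fin.castSucc_lt_succ_iff.1 (hi ▸ Fin.succ_lt_succ_iff.2 hlt)
  have hqi : q i = q j := le_antisymm ((hmono hik).trans hqjk.ge) (hmono hji)
  have hlow : LowerEstimate (B j.succ) (q j) := by
    rw [← hqi, ← hi]
    exact (hest i).1
  exact hnot (containsLq_of_estimates (hq j) (hX _ (Fin.succ_ne_zero j)
    (Fin.ne_last_of_lt (Fin.succ_lt_succ_iff.2 hlt))) hlow (hest j).2.1)

end LatticeEstimateDisjoint

end SplitUB

end

theorem mainTheorem2 {𝕜 : Type*} [RCLike 𝕜] {n : ℕ} {X : Fin (n + 1) → Type*}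
    [∀ j, NormedAddCommGroup (X j)] [∀ j, NormedSpace 𝕜 (X j)] [∀ j, CompleteSpace (X j)]
    {ι : Fin (n + 1) → Type*} [∀ j, Countable (ι j)]
    (hX : ∀ j, j ≠ 0 → j ≠ Fin.last n → ¬ FiniteDimensional 𝕜 (X j))
    (B : ∀ j, UnconditionalSchauderBasis (ι j) 𝕜 (X j))
    (hB : SplitUB.LatticeEstimateDisjoint B) :
    SplitUB.SplittingForUnconditionalBases 𝕜 X ∧
      ((∀ j, SplitUB.HasUTAPBasis 𝕜 (X j)) → SplitUB.HasUTAPBasis 𝕜 (∀ j, X j)) := by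
  have hs : SplitUB.SplittingForUnconditionalBases 𝕜 X :=
    SplitUB.splittingForUnconditionalBases_of_isCompactOperator
      (SplitUB.isCompactOperator_of_latticeEstimateDisjoint hX hB)
  exact ⟨hs, SplitUB.hasUTAPBasis_pi hs⟩
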